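/- Let $d\ge 1$, let $M\cong\mathbb Z^{d+1}$ be a lattice with dual lattice $N$, and let $\Delta\subset M_{\mathbb R}$ be a reflexive polytope, i.e. a lattice polytope whose dual $\{n\in N_{\mathbb R}:\langle m,n\rangle\le 1\ \forall m\in\Delta\}$ is also a lattice polytope. Let $h:\Delta\cap M\to\mathbb Z$ be a height function, i.e. $h(0)=0<h(m)$ for all $0\ne m\in\Delta\cap M$, and put $\Delta_h^\vee=\{n\in N_{\mathbb R}:\langle m,n\rangle\le h(m)\ \forall m\in\Delta\cap M\}$, $\tau_m=\{n\in\Delta^\vee_h:\langle m,n\rangle=h(m)\}$ for $m\in\Delta\cap M$, $A=\partial\Delta$, $B=\partial\Delta_h^\vee$. Let $A^\circ$, $B^\circ$ be the unions of the relative interiors of the facets of $\Delta$ and $\Delta_h^\vee$. For $m\in A$ let $\mathrm{St}(m)$ be the union of the closed faces of $A$ containing $m$. For a facet $\tau$ of $\Delta^\vee_h$ let $m_\tau\in M$ be its primitive outward normal. Let $\mu_M$ be the measure on $A$ carried by $A^\circ$ which on the relative interior of each facet is the Lebesgue measure normalized by the lattice of integral vectors tangent to the facet. Let $\nu_N$ be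 the measure on $B$ defined in the same way and then multiplied by the constant that gives it total mass $\mu_M(A)$. The pair $(\Delta,h)$ is structurally unstable if $\nu_N(\tau)>\mu_M(\mathrm{St}(m_\tau))$ for some facet $\tau$ of $\Delta_h^\vee$, or $\mu_M(\sigma)>\nu_N(\bigcup_{m\in\sigma\cap M}\tau_m)$ for some facet $\sigma$ of $\Delta$. It is structurally strictly semistable if it is not structurally unstable but $\nu_N(\tau)=\mu_M(\mathrm{St}(m_\tau))$ for some facet $\tau$ of $\Delta_h^\vee$, or $\mu_M(\sigma)=\nu_N(\bigcup_{m\in\sigma\cap M}\tau_m)$ for some facet $\sigma$ of $\Delta$. Let $\mathcal P(\Delta)$ be the set of convex functions $\Psi:N_{\mathbb R}\to\mathbb R$ with $\sup_{n}|\Psi(n)-\sup_{m\in\Delta\cap M}\langle m,n\rangle|<\infty$. A function $\Psi\in\mathcal P(\Delta)$ solves the Monge–Ampère equation $\mathrm{MA}(\Psi|_{B^\circ})=\nu_N$ if, for each facet $\tau$ of $\Delta_h^\vee$ with relative interior $\tau^\circ$, each Borel set $E\subset\tau^\circ$ and an integral affine coordinate map $\beta:\tau^\circ\to\mathbb R^d$,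 the Lebesgue measure of $\partial(\Psi\circ\beta^{-1})(\beta(E))$ is $\nu_N(E)$; here $\partial$ is the subgradient on $\beta(\tau^\circ)$. For $\Psi\in\mathcal P(\Delta)$ and $m\in A$ let $\Psi^c(m)=\sup_{n\in B}(\langle m,n\rangle-\Psi(n))$ and $\partial^c\Psi^c(m)=\{n\in B:\Psi^c(m')\ge\Psi^c(m)+\langle m'-m,n\rangle\ \forall m'\in A\}$. For a facet $\sigma$ of $\Delta$ with relative interior $\sigma^\circ$ let $U_\sigma=B\setminus\partial^c\Psi^c(A\setminus\sigma^\circ)$, where the image of a set is the union of the images of its points, and let $\Sigma_\Psi=(B\setminus B^\circ)\setminus\bigcup_\sigma U_\sigma$. If $(\Delta,h)$ is structurally strictly semistable and $\Psi\in\mathcal P(\Delta)$ solves $\mathrm{MA}(\Psi|_{B^\circ})=\nu_N$, then $B\setminus\Sigma_\Psi$ is not connected. In particular $\Sigma_\Psi$ has codimension $1$ in $B$: it is non-empty and its Hausdorff dimension is $d-1$. -/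

import Mathlib

open Set MeasureTheory
open scoped ENNReal

noncomputable section

namespace TropicalMA

/-! The lattices `M` and `N` are both `ℤ^(d+1)`, in dual bases, so that the pairing between
`M_ℝ = ℝ^(d+1)` and `N_ℝ = ℝ^(d+1)` is the dot product. -/

variable {d : ℕ}

/-- The inclusion of the lattice `ℤ^(d+1)` in `ℝ^(d+1)`. -/
def toR (m : Fin (d + 1) → ℤ) : Fin (d + 1) → ℝ := fun i => (m i : ℝ)

/-- A lattice polytope: the convex hull of finitely many lattice points. -/
def IsLatticePolytope (P : Set (Fin (d + 1) → ℝ)) : Prop :=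
  ∃ S : Finset (Fin (d + 1) → ℤ), P = convexHull ℝ (toR '' (S : Set (Fin (d + 1) → ℤ)))

/-- The dual `{n | ⟨m, n⟩ ≤ 1 for all m ∈ P}`. -/
def dualPolytope (P : Set (Fin (d + 1) → ℝ)) : Set (Fin (d + 1) → ℝ) :=
  {n | ∀ m ∈ P, m ⬝ᵥ n ≤ 1}

/-- A reflexive polytope: a lattice polytope whose dual is also a lattice polytope.
(Boundedness of the dual forces the origin to be an interior point.) -/
def IsReflexive (Δ : Set (Fin (d + 1) → ℝ)) : Prop :=
  IsLatticePolytope Δ ∧ IsLatticePolytope (dualPolytope Δ)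

/-- A height function on `Δ ∩ M`; only the values of `h` at lattice points of `Δ` matter. -/
def IsHeight (Δ : Set (Fin (d + 1) → ℝ)) (h : (Fin (d + 1) → ℤ) → ℤ) : Prop :=
  h 0 = 0 ∧ ∀ m, toR m ∈ Δ → m ≠ 0 → 0 < h m

/-- The polytope `Δ_h^∨ = {n | ⟨m, n⟩ ≤ h(m) for all m ∈ Δ ∩ M}`. -/
def dualH (Δ : Set (Fin (d + 1) → ℝ)) (h : (Fin (d + 1) → ℤ) → ℤ) : Set (Fin (d + 1) → ℝ) :=
  {n | ∀ m, toR m ∈ Δ → toR m ⬝ᵥ n ≤ (h m : ℝ)}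

/-- The face `τ_m = {n ∈ Δ_h^∨ | ⟨m, n⟩ = h(m)}` of `Δ_h^∨` dual to `m`. -/
def tau (Δ : Set (Fin (d + 1) → ℝ)) (h : (Fin (d + 1) → ℤ) → ℤ) (m : Fin (d + 1) → ℤ) :
    Set (Fin (d + 1) → ℝ) :=
  {n ∈ dualH Δ h | toR m ⬝ᵥ n = (h m : ℝ)}

/-! ### Facets, described by their primitive outward normals -/

/-- A primitive lattice vector. -/
def IsPrimitive (u : Fin (d + 1) → ℤ) : Prop :=
  ∀ q : ℤ, (∀ i, q ∣ u i) → IsUnit q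

/-- The face of `P` on which the functional `u` is maximal. -/
def face (P : Set (Fin (d + 1) → ℝ)) (u : Fin (d + 1) → ℤ) : Set (Fin (d + 1) → ℝ) :=
  {x ∈ P | ∀ y ∈ P, toR u ⬝ᵥ y ≤ toR u ⬝ᵥ x}

/-- `u` is the primitive outward normal of a facet (a `d`-dimensional face) of `P`, that facet
being `face P u`. For polytopes with rational facets this is a bijection between such `u` and
facets. -/
def IsFacetNormal (P : Set (Fin (d + 1) → ℝ)) (u : Fin (d + 1) → ℤ) : Prop :=
  IsPrimitive u ∧ Module.finrank ℝ (vectorSpan ℝ (face P u)) = d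

/-- The relative interior of the face with normal `u`. -/
def faceInterior (P : Set (Fin (d + 1) → ℝ)) (u : Fin (d + 1) → ℤ) : Set (Fin (d + 1) → ℝ) :=
  intrinsicInterior ℝ (face P u)

/-- The union of the relative interiors of the facets of `P` (`A°` or `B°`). -/
def openFacets (P : Set (Fin (d + 1) → ℝ)) : Set (Fin (d + 1) → ℝ) :=
  ⋃ (u : Fin (d + 1) → ℤ) (_ : IsFacetNormal P u), faceInterior P u

/-- The closed star of `m`: the union of all closed faces of the boundary of `P` containing
`m`. -/
def star (P : Set (Fin (d + 1) → ℝ)) (m : Fin (d + 1) → ℝ) : Set (Fin (d + 1) → ℝ) :=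
  {x | ∃ F, IsExposed ℝ P F ∧ F ≠ P ∧ m ∈ F ∧ x ∈ F}

/-- `⋃_{m ∈ σ ∩ M} τ_m` for the facet `σ` of `Δ` with normal `v`. -/
def dualStar (Δ : Set (Fin (d + 1) → ℝ)) (h : (Fin (d + 1) → ℤ) → ℤ) (v : Fin (d + 1) → ℤ) :
    Set (Fin (d + 1) → ℝ) :=
  ⋃ (m : Fin (d + 1) → ℤ) (_ : toR m ∈ face Δ v), tau Δ h m

/-! ### The integral affine structure and the integral Lebesgue measure on the facets -/

/-- The lattice `u^⊥` of integral tangent vectors of a facet with normal `u`. -/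
def perp (u : Fin (d + 1) → ℤ) : Submodule ℤ (Fin (d + 1) → ℤ) where
  carrier := {v | u ⬝ᵥ v = 0}
  add_mem' := by
    intro a b ha hb
    change u ⬝ᵥ a = 0 at ha; change u ⬝ᵥ b = 0 at hb; change u ⬝ᵥ (a + b) = 0
    rw [dotProduct_add, ha, hb, add_zero]
  zero_mem' := dotProduct_zero u
  smul_mem' := by
    intro c a ha
    change u ⬝ᵥ a = 0 at ha; change u ⬝ᵥ (c • a) = 0
    rw [dotProduct_smul, ha, smul_zero]

/-- Some point of the hyperplane which supports `P` in the direction `u`. -/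
def basePoint (P : Set (Fin (d + 1) → ℝ)) (u : Fin (d + 1) → ℤ) : Fin (d + 1) → ℝ :=
  (sSup ((fun x => toR u ⬝ᵥ x) '' P) / (toR u ⬝ᵥ toR u)) • toR u

/-- Inverse of an integral affine coordinate map of the supporting hyperplane of `P` with normal
`u`: it parametrizes that hyperplane by means of a `ℤ`-basis of the lattice `u^⊥`. (For `u ≠ 0`
the number of coordinates, the rank of `u^⊥`, is `d`.) Another choice of basis or of base point
changes it by an affine map with linear part in `GL_d(ℤ)`. -/
def param (P : Set (Fin (d + 1) → ℝ)) (u : Fin (d + 1) → ℤ) :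
    (Fin (Module.finrank ℤ (perp u)) → ℝ) → (Fin (d + 1) → ℝ) :=
  fun y => basePoint P u + ∑ j, y j • toR (Module.finBasis ℤ (perp u) j : Fin (d + 1) → ℤ)

/-- The integral Lebesgue measure on the union of the open facets of `P`. -/
def integralMeasure (P : Set (Fin (d + 1) → ℝ)) : Measure (Fin (d + 1) → ℝ) :=
  Measure.sum fun u : {u : Fin (d + 1) → ℤ // IsFacetNormal P u} =>
    (Measure.map (param P u.1) volume).restrict (faceInterior P u.1)

/-- The measure `μ_M` on `A = ∂Δ`. -/
def muM (Δ : Set (Fin (d + 1) → ℝ)) : Measure (Fin (d + 1) → ℝ) := integralMeasure Δ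

/-- The measure `ν_N` on `B = ∂Δ_h^∨`, normalized to have the total mass of `μ_M`. -/
def nuN (Δ : Set (Fin (d + 1) → ℝ)) (h : (Fin (d + 1) → ℤ) → ℤ) : Measure (Fin (d + 1) → ℝ) :=
  (muM Δ (frontier Δ) / integralMeasure (dualH Δ h) (frontier (dualH Δ h))) •
    integralMeasure (dualH Δ h)

/-! ### Structural (semi)stability -/

def StructurallyUnstable (Δ : Set (Fin (d + 1) → ℝ)) (h : (Fin (d + 1) → ℤ) → ℤ) : Prop :=
  (∃ u, IsFacetNormal (dualH Δ h) u ∧ muM Δ (star Δ (toR u)) < nuN Δ h (face (dualH Δ h) u)) ∨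
  (∃ v, IsFacetNormal Δ v ∧ nuN Δ h (dualStar Δ h v) < muM Δ (face Δ v))

def StructurallyStrictlySemistable (Δ : Set (Fin (d + 1) → ℝ)) (h : (Fin (d + 1) → ℤ) → ℤ) :
    Prop :=
  ¬ StructurallyUnstable Δ h ∧
  ((∃ u, IsFacetNormal (dualH Δ h) u ∧ nuN Δ h (face (dualH Δ h) u) = muM Δ (star Δ (toR u))) ∨
   (∃ v, IsFacetNormal Δ v ∧ muM Δ (face Δ v) = nuN Δ h (dualStar Δ h v)))

/-! ### The Monge–Ampère equation -/

/-- The class `𝒫(Δ)`: convex functions on `N_ℝ` at bounded distance from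
`n ↦ sup_{m ∈ Δ ∩ M} ⟨m, n⟩`. -/
def MemP (Δ : Set (Fin (d + 1) → ℝ)) (Ψ : (Fin (d + 1) → ℝ) → ℝ) : Prop :=
  ConvexOn ℝ univ Ψ ∧
  ∃ C : ℝ, ∀ n, |Ψ n - sSup ((fun m => toR m ⬝ᵥ n) '' {m | toR m ∈ Δ})| ≤ C

/-- The gradient at `y` of a function `f` on `D`. -/
def subgradient {k : ℕ} (D : Set (Fin k → ℝ)) (f : (Fin k → ℝ) → ℝ) (y : Fin k → ℝ) :
    Set (Fin k → ℝ) :=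
  {x | ∀ y' ∈ D, f y + x ⬝ᵥ (y' - y) ≤ f y'}

/-- The Monge–Ampère measure of `Ψ` on the open facet of `P` with normal `u`, evaluated at a
subset `S` of that facet: the Lebesgue measure of the gradient image of `S` in integral affine
coordinates. -/
def mongeAmpere (P : Set (Fin (d + 1) → ℝ)) (u : Fin (d + 1) → ℤ) (Ψ : (Fin (d + 1) → ℝ) → ℝ)
    (S : Set (Fin (d + 1) → ℝ)) : ℝ≥0∞ :=
  volume (⋃ y ∈ param P u ⁻¹' S,
    subgradient (param P u ⁻¹' faceInterior P u) (Ψ ∘ param P u) y)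

/-- `Ψ ∈ 𝒫(Δ)` solves `MA(Ψ|_{B°}) = ν_N`. -/
def IsSolution (Δ : Set (Fin (d + 1) → ℝ)) (h : (Fin (d + 1) → ℤ) → ℤ)
    (Ψ : (Fin (d + 1) → ℝ) → ℝ) : Prop :=
  MemP Δ Ψ ∧
  ∀ u, IsFacetNormal (dualH Δ h) u → ∀ S, MeasurableSet S → S ⊆ faceInterior (dualH Δ h) u →
    mongeAmpere (dualH Δ h) u Ψ S = nuN Δ h S

/-! ### The singular set -/

/-- The `c`-transform `Ψ^c(m) = sup_{n ∈ B} ⟨m, n⟩ - Ψ(n)`, where `B = ∂Δ_h^∨`. -/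
def cTransform (Δ : Set (Fin (d + 1) → ℝ)) (h : (Fin (d + 1) → ℤ) → ℤ)
    (Ψ : (Fin (d + 1) → ℝ) → ℝ) (m : Fin (d + 1) → ℝ) : ℝ :=
  sSup ((fun n => m ⬝ᵥ n - Ψ n) '' frontier (dualH Δ h))

/-- The `c`-gradient at `m ∈ A` of a function `Φ` on `A = ∂Δ`, a subset of `B = ∂Δ_h^∨`. -/
def cGradient (Δ : Set (Fin (d + 1) → ℝ)) (h : (Fin (d + 1) → ℤ) → ℤ)
    (Φ : (Fin (d + 1) → ℝ) → ℝ) (m : Fin (d + 1) → ℝ) : Set (Fin (d + 1) → ℝ) :=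
  {n ∈ frontier (dualH Δ h) | ∀ m' ∈ frontier Δ, Φ m + (m' - m) ⬝ᵥ n ≤ Φ m'}

/-- `U_σ = B ∖ ∂^cΨ^c(A ∖ σ°)` for the facet `σ` of `Δ` with normal `v`. -/
def chartDomain (Δ : Set (Fin (d + 1) → ℝ)) (h : (Fin (d + 1) → ℤ) → ℤ)
    (Ψ : (Fin (d + 1) → ℝ) → ℝ) (v : Fin (d + 1) → ℤ) : Set (Fin (d + 1) → ℝ) :=
  frontier (dualH Δ h) \
    ⋃ m ∈ frontier Δ \ faceInterior Δ v, cGradient Δ h (cTransform Δ h Ψ) m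

/-- `Σ_Ψ = (B ∖ B°) ∖ ⋃_σ U_σ`. -/
def singularSet (Δ : Set (Fin (d + 1) → ℝ)) (h : (Fin (d + 1) → ℤ) → ℤ)
    (Ψ : (Fin (d + 1) → ℝ) → ℝ) : Set (Fin (d + 1) → ℝ) :=
  (frontier (dualH Δ h) \ openFacets (dualH Δ h)) \
    ⋃ (v : Fin (d + 1) → ℤ) (_ : IsFacetNormal Δ v), chartDomain Δ h Ψ v

end TropicalMA

end

noncomputable section

namespace TropicalMA

variable {d : ℕ}

/-! A solution `Ψ` moves mass from `B` to `A` and cannot lose any. Let `X` lie in the open facet of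
`dualH Δ h` with normal `u`. By the Monge–Ampère equation the subgradients of `Ψ` over `X`, which
live in `M_ℝ` modulo `u`, have volume `ν_N(X)`. Each lifts to a point of `Δ`. Pushed along `u` until
it leaves `Δ`, this point lands on a face `⟨v, ·⟩ = 1` with `⟨v, u⟩ = 1`, and there the supremum
defining `Ψ^c` is attained at a point of `X`. Projection modulo `u` preserves integral volume on
such facets, so `ν_N(X)` is at most the `μ_M`-mass of the resulting set, the `transport` of `X`,
which lies in the star of `u` (`nuN_le_muM_transport`). As `Ψ^c` is Lipschitz, Rademacher's theorem
makes the transports of disjoint sets almost disjoint (`muM_transport_inter`).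

If `ν_N(τ) = μ_M(St(m_τ))`, the transport of `τ` already uses up the mass of the star. If another
facet met `U_σ` with `σ` in the star, the intersection would have positive mass and would also be
transported into `σ`, which is too much. So `τ` meets only the `U_σ` with `σ` in the star, and the
other facets meet only the remaining ones. Open facets and charts cover `B ∖ Σ_Ψ`, and each of the
two families is disjoint, so this sorting disconnects it (`not_isPreconnected_of_partition`).
Equality for a facet `σ` of `Δ` is handled by the same count on `A ∖ σ`.

Finally `Σ_Ψ` lies in the codimension-one skeleton of `B`, whereas removing a set of Hausdorff
dimension less than `d - 1` leaves `B` connected (`isPreconnected_frontier_diff`). -/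

theorem continuous_dotProduct_left {n : ℕ} (a : Fin n → ℝ) : Continuous fun x => a ⬝ᵥ x := by
  unfold dotProduct; fun_prop

/-! ### Lattice vectors and the dot product -/

theorem toR_dotProduct_toR (a b : Fin (d + 1) → ℤ) :
    toR a ⬝ᵥ toR b = ((a ⬝ᵥ b : ℤ) : ℝ) := by
  simp [toR, dotProduct]

theorem toR_injective : Function.Injective (toR : (Fin (d + 1) → ℤ) → _) := by
  intro a b hab
  funext i
  have := congrFun hab i
  simpa [toR] using this

theorem toR_zero : toR (0 : Fin (d + 1) → ℤ) = 0 := by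
  funext i; simp [toR]

theorem toR_add (a b : Fin (d + 1) → ℤ) : toR (a + b) = toR a + toR b := by
  funext i; simp [toR]

theorem toR_smul (k : ℤ) (a : Fin (d + 1) → ℤ) : toR (k • a) = (k : ℝ) • toR a := by
  funext i; simp [toR]

/-- The linear functional given by the dot product with `a`. -/
def dotLin {n : ℕ} (a : Fin n → ℝ) : (Fin n → ℝ) →ₗ[ℝ] ℝ where
  toFun x := a ⬝ᵥ x
  map_add' := dotProduct_add a
  map_smul' c x := by simp [dotProduct_smul]

@[simp] theorem dotLin_apply {n : ℕ} (a x : Fin n → ℝ) : dotLin a x = a ⬝ᵥ x := rfl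

theorem dotLin_ne_zero {n : ℕ} {a : Fin n → ℝ} (ha : a ≠ 0) : dotLin a ≠ 0 := by
  intro h
  exact ha (dotProduct_eq_zero a fun w => by simpa using LinearMap.congr_fun h w)

theorem finrank_ker_dotLin {a : Fin (d + 1) → ℝ} (ha : a ≠ 0) :
    Module.finrank ℝ (LinearMap.ker (dotLin a)) = d := by
  have := Module.Dual.finrank_ker_add_one_of_ne_zero (dotLin_ne_zero ha)
  simpa using this

theorem exists_smul_eq_of_ker_le {a b : Fin (d + 1) → ℝ}
    (h : ∀ x, a ⬝ᵥ x = 0 → b ⬝ᵥ x = 0) : ∃ c : ℝ, b = c • a := by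
  by_cases ha : a = 0
  · refine ⟨0, ?_⟩
    simp only [zero_smul]
    exact dotProduct_eq_zero b fun w => h w (by simp [ha])
  · refine ⟨b ⬝ᵥ a / a ⬝ᵥ a, ?_⟩
    have haa : a ⬝ᵥ a ≠ 0 := by simpa using ha
    refine dotProduct_eq _ _ fun w => ?_
    have := h (w - (a ⬝ᵥ w / a ⬝ᵥ a) • a) (by
      simp [dotProduct_sub, dotProduct_smul, div_mul_cancel₀ _ haa])
    rw [dotProduct_sub, dotProduct_smul, sub_eq_zero] at this
    rw [this, smul_dotProduct]
    simp only [smul_eq_mul]; ring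

theorem dotProduct_self_pos {n : ℕ} {a : Fin n → ℝ} (ha : a ≠ 0) : 0 < a ⬝ᵥ a :=
  lt_of_le_of_ne (Finset.sum_nonneg fun i _ => mul_self_nonneg (a i))
    fun h => ha (dotProduct_self_eq_zero.1 h.symm)

/-- A presentation of a bounded polytope by inequalities `⟨m, x⟩ ≤ h m`, with `0` in the interior
and with unimodular vectors `m`. -/
structure Presents (P : Set (Fin (d + 1) → ℝ)) (S : Finset (Fin (d + 1) → ℤ))
    (h : (Fin (d + 1) → ℤ) → ℝ) : Prop where
  mem_iff : ∀ x, x ∈ P ↔ ∀ m ∈ S, toR m ⬝ᵥ x ≤ h m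
  pos : ∀ m ∈ S, 0 < h m
  unimodular : ∀ m ∈ S, ∃ w : Fin (d + 1) → ℤ, w ⬝ᵥ m = 1
  bounded : Bornology.IsBounded P

/-- Both vectors pair to 1 with a lattice vector, so the ratio `c` and its inverse are integers.
This is how proportional inequalities are recognized as equal. -/
theorem eq_of_smul_eq {m m' w w' : Fin (d + 1) → ℤ} {c : ℝ} (hm : w ⬝ᵥ m = 1) (hm' : w' ⬝ᵥ m' = 1)
    (hc : 0 < c) (h : toR m' = c • toR m) : m' = m := by
  have h1 : ((w ⬝ᵥ m' : ℤ) : ℝ) = c := by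
    rw [← toR_dotProduct_toR, h, dotProduct_smul, toR_dotProduct_toR, hm]; simp
  have h2 : m' = (w ⬝ᵥ m') • m := toR_injective (by rw [toR_smul, h1, h])
  have h3 : (w ⬝ᵥ m') * (w' ⬝ᵥ m) = 1 := by
    conv_rhs => rw [← hm', h2]
    rw [dotProduct_smul]; simp
  have h4 : 0 < w ⬝ᵥ m' := by rw [← h1] at hc; exact_mod_cast hc
  have h5 : w ⬝ᵥ m' = 1 := by
    rcases Int.isUnit_iff.1 (IsUnit.of_mul_eq_one _ h3) with h | h <;> omega
  rw [h2, h5, one_smul]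

theorem isPrimitive_of_dotProduct_eq_one {m w : Fin (d + 1) → ℤ} (h : w ⬝ᵥ m = 1) :
    IsPrimitive m := by
  intro q hq
  refine isUnit_of_dvd_one ?_
  rw [← h]
  exact Finset.dvd_sum fun i _ => Dvd.dvd.mul_left (hq i) _

theorem IsPrimitive.ne_zero {u : Fin (d + 1) → ℤ} (hu : IsPrimitive u) : u ≠ 0 := by
  rintro rfl
  have := hu 2 (by simp)
  rw [Int.isUnit_iff] at this
  omega

theorem toR_ne_zero {u : Fin (d + 1) → ℤ} (hu : u ≠ 0) : toR u ≠ 0 := by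
  rw [← toR_zero]; exact toR_injective.ne hu

/-! ### Facets of a polytope given by inequalities -/

namespace Presents

variable {P : Set (Fin (d + 1) → ℝ)} {S : Finset (Fin (d + 1) → ℤ)} {h : (Fin (d + 1) → ℤ) → ℝ}

theorem ne_zero (hP : Presents P S h) {m : Fin (d + 1) → ℤ} (hm : m ∈ S) : m ≠ 0 := by
  rintro rfl
  obtain ⟨w, hw⟩ := hP.unimodular 0 hm
  simp at hw

theorem zero_mem (hP : Presents P S h) : (0 : Fin (d + 1) → ℝ) ∈ P :=
  (hP.mem_iff 0).2 fun m hm => by simpa using (hP.pos m hm).le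

theorem eq_iInter (hP : Presents P S h) : P = ⋂ m ∈ S, {x | toR m ⬝ᵥ x ≤ h m} := by
  ext x; simp [hP.mem_iff x]

theorem isClosed (hP : Presents P S h) : IsClosed P := by
  rw [hP.eq_iInter]
  exact isClosed_biInter fun m _ => isClosed_le (continuous_dotProduct_left _) continuous_const

theorem convex (hP : Presents P S h) : Convex ℝ P := by
  rw [hP.eq_iInter]
  exact convex_iInter₂ fun m _ => convex_halfSpace_le (dotLin (toR m)).isLinear _

theorem isCompact (hP : Presents P S h) : IsCompact P :=
  Metric.isCompact_of_isClosed_isBounded hP.isClosed hP.bounded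

theorem isOpen_strict (S : Finset (Fin (d + 1) → ℤ)) (h : (Fin (d + 1) → ℤ) → ℝ) :
    IsOpen {x : Fin (d + 1) → ℝ | ∀ m ∈ S, toR m ⬝ᵥ x < h m} := by
  have : {x : Fin (d + 1) → ℝ | ∀ m ∈ S, toR m ⬝ᵥ x < h m} =
      ⋂ m ∈ S, {x | toR m ⬝ᵥ x < h m} := by ext; simp
  rw [this]
  exact isOpen_biInter_finset fun m _ => isOpen_lt (continuous_dotProduct_left _) continuous_const

theorem interior_eq (hP : Presents P S h) :
    interior P = {x | ∀ m ∈ S, toR m ⬝ᵥ x < h m} := by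
  apply Subset.antisymm
  · intro x hx m hm
    have hxP := interior_subset hx
    refine lt_of_le_of_ne ((hP.mem_iff x).1 hxP m hm) fun he => ?_
    have hc : Continuous fun t : ℝ => x + t • toR m := by fun_prop
    have h1 : ∀ᶠ t in nhds (0 : ℝ), x + t • toR m ∈ interior P :=
      hc.continuousAt.eventually_mem (isOpen_interior.mem_nhds (by simpa using hx))
    obtain ⟨t, ht, ht0⟩ := ((h1.filter_mono nhdsWithin_le_nhds).and
      (self_mem_nhdsWithin (a := (0 : ℝ)) (s := Ioi 0))).exists
    have h2 := (hP.mem_iff _).1 (interior_subset ht) m hm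
    rw [dotProduct_add, dotProduct_smul, he] at h2
    have h3 := dotProduct_self_pos (toR_ne_zero (hP.ne_zero hm))
    have := mul_pos (mem_Ioi.1 ht0) h3
    simp only [smul_eq_mul] at h2
    linarith
  · exact interior_maximal (fun x hx => (hP.mem_iff x).2 fun m hm => (hx m hm).le)
      (isOpen_strict S h)

theorem mem_frontier_iff (hP : Presents P S h) {x : Fin (d + 1) → ℝ} :
    x ∈ frontier P ↔ x ∈ P ∧ ∃ m ∈ S, toR m ⬝ᵥ x = h m := by
  rw [frontier, hP.isClosed.closure_eq, hP.interior_eq]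
  simp only [mem_sdiff, mem_ofPred_eq, not_forall, not_lt, exists_prop]
  refine and_congr_right fun hx => exists_congr fun m => and_congr_right fun hm => ?_
  exact ⟨fun hle => le_antisymm ((hP.mem_iff x).1 hx m hm) hle, fun he => he.ge⟩

theorem mem_nhds_zero (hP : Presents P S h) : P ∈ nhds (0 : Fin (d + 1) → ℝ) := by
  rw [mem_nhds_iff]
  refine ⟨interior P, interior_subset, isOpen_interior, ?_⟩
  rw [hP.interior_eq]
  intro m hm
  simpa using hP.pos m hm

theorem frontier_subset (hP : Presents P S h) : frontier P ⊆ P :=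
  fun _ hx => (hP.mem_frontier_iff.1 hx).1

theorem isCompact_frontier (hP : Presents P S h) : IsCompact (frontier P) :=
  hP.isCompact.of_isClosed_subset isClosed_frontier hP.frontier_subset

/-- For `d = 0` an empty face would also have a span of dimension `d`; this is why `1 ≤ d` is
needed. -/
theorem nonempty_of_isFacetNormal (hd : 1 ≤ d) {u : Fin (d + 1) → ℤ} (hu : IsFacetNormal P u) :
    (face P u).Nonempty := by
  by_contra he
  have := hu.2
  rw [not_nonempty_iff_eq_empty.1 he, vectorSpan_empty, finrank_bot] at this
  omega

/-- If every inequality were strict somewhere on the face, taking midpoints would give a point of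
the face where all are strict. That point is interior to `P`, where the functional `u` has no
maximum. -/
theorem exists_tight (hP : Presents P S h) {u : Fin (d + 1) → ℤ} (hu : u ≠ 0)
    (hF : (face P u).Nonempty) : ∃ m ∈ S, ∀ x ∈ face P u, toR m ⬝ᵥ x = h m := by
  by_contra hcon
  push Not at hcon
  have hle : ∀ x ∈ face P u, ∀ m ∈ S, toR m ⬝ᵥ x ≤ h m := fun x hx m hm =>
    (hP.mem_iff x).1 hx.1 m hm
  -- the points of the face that are strictly inside finitely many of the inequalities
  have key : ∀ T : Finset (Fin (d + 1) → ℤ), T ⊆ S →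
      ∃ x ∈ face P u, ∀ m ∈ T, toR m ⬝ᵥ x < h m := by
    intro T
    induction T using Finset.induction_on with
    | empty => intro _; obtain ⟨x, hx⟩ := hF; exact ⟨x, hx, by simp⟩
    | insert a T _ ih =>
      intro hT
      obtain ⟨x, hx, hxT⟩ := ih fun m hm => hT (Finset.mem_insert_of_mem hm)
      obtain ⟨y, hy, hya⟩ := hcon a (hT (Finset.mem_insert_self _ _))
      have hya' := lt_of_le_of_ne (hle y hy a (hT (Finset.mem_insert_self _ _))) hya
      have hcomb : ∀ m : Fin (d + 1) → ℤ, toR m ⬝ᵥ ((1 / 2 : ℝ) • x + (1 / 2 : ℝ) • y) =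
          (toR m ⬝ᵥ x + toR m ⬝ᵥ y) / 2 := by
        intro m; rw [dotProduct_add, dotProduct_smul, dotProduct_smul]; simp; ring
      refine ⟨(1 / 2 : ℝ) • x + (1 / 2 : ℝ) • y, ⟨?_, ?_⟩, ?_⟩
      · exact hP.convex hx.1 hy.1 (by norm_num) (by norm_num) (by norm_num)
      · intro z hz
        rw [hcomb]
        linarith [hx.2 z hz, hy.2 z hz]
      · intro m hm
        rw [hcomb]
        rcases Finset.mem_insert.1 hm with rfl | hm'
        · linarith [hle x hx m (hT hm)]
        · linarith [hxT m hm', hle y hy m (hT hm)]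
  obtain ⟨x, hx, hxS⟩ := key S subset_rfl
  have hxi : x ∈ interior P := by rw [hP.interior_eq]; exact hxS
  have hc : Continuous fun t : ℝ => x + t • toR u := by fun_prop
  have h1 : ∀ᶠ t in nhds (0 : ℝ), x + t • toR u ∈ interior P :=
    hc.continuousAt.eventually_mem (isOpen_interior.mem_nhds (by simpa using hxi))
  obtain ⟨t, ht, ht0⟩ := ((h1.filter_mono nhdsWithin_le_nhds).and
    (self_mem_nhdsWithin (a := (0 : ℝ)) (s := Ioi 0))).exists
  have h2 := hx.2 _ (interior_subset ht)
  rw [dotProduct_add, dotProduct_smul] at h2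
  have h3 := dotProduct_self_pos (toR_ne_zero hu)
  have := mul_pos (mem_Ioi.1 ht0) h3
  simp only [smul_eq_mul] at h2
  linarith

/-- By dimension, both kernels equal the span of the face, so `u` is a multiple of `m`. The factor
is an integer by unimodularity, a unit because `u` is primitive, and nonnegative because `0 ∈ P`. -/
theorem eq_of_tight (hP : Presents P S h) (hd : 1 ≤ d) {u m : Fin (d + 1) → ℤ}
    (hu : IsFacetNormal P u) (hm : m ∈ S) (ht : ∀ x ∈ face P u, toR m ⬝ᵥ x = h m) : u = m := by
  obtain ⟨x₀, hx₀⟩ := nonempty_of_isFacetNormal hd hu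
  have hspan : ∀ (a : Fin (d + 1) → ℝ) (c : ℝ), a ≠ 0 → (∀ x ∈ face P u, a ⬝ᵥ x = c) →
      vectorSpan ℝ (face P u) = LinearMap.ker (dotLin a) := by
    intro a c ha hx
    refine Submodule.eq_of_le_of_finrank_eq ?_ (by rw [hu.2, finrank_ker_dotLin ha])
    rw [vectorSpan_def, Submodule.span_le]
    rintro _ ⟨x, hx', y, hy', rfl⟩
    simp [dotProduct_sub, hx x hx', hx y hy']
  have h1 := hspan (toR m) (h m) (toR_ne_zero (hP.ne_zero hm)) ht
  have h2 := hspan (toR u) (toR u ⬝ᵥ x₀) (toR_ne_zero hu.1.ne_zero)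
    fun x hx => le_antisymm (hx₀.2 x hx.1) (hx.2 x₀ hx₀.1)
  obtain ⟨c, hc⟩ := exists_smul_eq_of_ker_le (a := toR m) (b := toR u) fun x hx => by
    have : x ∈ LinearMap.ker (dotLin (toR u)) := by rw [← h2, h1]; simpa using hx
    simpa using this
  obtain ⟨w, hw⟩ := hP.unimodular m hm
  have hcw : ((w ⬝ᵥ u : ℤ) : ℝ) = c := by
    rw [← toR_dotProduct_toR, hc, dotProduct_smul, toR_dotProduct_toR, hw]; simp
  have hum : u = (w ⬝ᵥ u) • m := toR_injective (by rw [toR_smul, hcw, hc])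
  have hunit := hu.1 (w ⬝ᵥ u) fun i => by
    conv_rhs => rw [hum]
    simp
  have hc0 : 0 ≤ c := by
    have := hx₀.2 0 hP.zero_mem
    rw [hc, smul_dotProduct, smul_dotProduct, ht x₀ hx₀] at this
    simp only [dotProduct_zero, smul_eq_mul, mul_zero] at this
    exact nonneg_of_mul_nonneg_left this (hP.pos m hm)
  have h5 : w ⬝ᵥ u = 1 := by
    rw [← hcw] at hc0
    have : 0 ≤ w ⬝ᵥ u := by exact_mod_cast hc0
    rcases Int.isUnit_iff.1 hunit with h | h <;> omega
  rw [hum, h5, one_smul]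

theorem mem_of_isFacetNormal (hP : Presents P S h) (hd : 1 ≤ d) {u : Fin (d + 1) → ℤ}
    (hu : IsFacetNormal P u) : u ∈ S := by
  obtain ⟨m, hm, ht⟩ := hP.exists_tight hu.1.ne_zero (nonempty_of_isFacetNormal hd hu)
  rw [hP.eq_of_tight hd hu hm ht]; exact hm

/-- The point `x₀` is required because an inequality in `S` may be redundant, with its bound never
attained. -/
theorem face_eq_of_tight (hP : Presents P S h) {u : Fin (d + 1) → ℤ} (hu : u ∈ S)
    {x₀ : Fin (d + 1) → ℝ} (hx₀ : x₀ ∈ P) (ht : toR u ⬝ᵥ x₀ = h u) :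
    face P u = {x ∈ P | toR u ⬝ᵥ x = h u} := by
  ext x
  refine and_congr_right fun hx => ⟨fun hmax => ?_, fun he y hy => ?_⟩
  · exact le_antisymm ((hP.mem_iff x).1 hx u hu) (ht ▸ hmax x₀ hx₀)
  · rw [he]; exact (hP.mem_iff y).1 hy u hu

theorem face_eq (hP : Presents P S h) (hd : 1 ≤ d) {u : Fin (d + 1) → ℤ}
    (hu : IsFacetNormal P u) : face P u = {x ∈ P | toR u ⬝ᵥ x = h u} := by
  obtain ⟨x₀, hx₀⟩ := nonempty_of_isFacetNormal hd hu
  obtain ⟨m, hm, ht⟩ := hP.exists_tight hu.1.ne_zero ⟨x₀, hx₀⟩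
  obtain rfl := hP.eq_of_tight hd hu hm ht
  exact hP.face_eq_of_tight hm hx₀.1 (ht x₀ hx₀)

theorem sSup_eq_of_tight (hP : Presents P S h) {u : Fin (d + 1) → ℤ} (hu : u ∈ S)
    {x₀ : Fin (d + 1) → ℝ} (hx₀ : x₀ ∈ P) (ht : toR u ⬝ᵥ x₀ = h u) :
    sSup ((fun x => toR u ⬝ᵥ x) '' P) = h u :=
  IsGreatest.csSup_eq ⟨⟨x₀, hx₀, ht⟩, by rintro _ ⟨y, hy, rfl⟩; exact (hP.mem_iff y).1 hy u hu⟩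

/-- The points of `P` at which `u` is the only tight inequality. -/
def tightOnly (S : Finset (Fin (d + 1) → ℤ)) (h : (Fin (d + 1) → ℤ) → ℝ)
    (u : Fin (d + 1) → ℤ) : Set (Fin (d + 1) → ℝ) :=
  {x | toR u ⬝ᵥ x = h u ∧ ∀ m ∈ S, m ≠ u → toR m ⬝ᵥ x < h m}

theorem isOpen_others (S : Finset (Fin (d + 1) → ℤ)) (h : (Fin (d + 1) → ℤ) → ℝ)
    (u : Fin (d + 1) → ℤ) :
    IsOpen {x : Fin (d + 1) → ℝ | ∀ m ∈ S, m ≠ u → toR m ⬝ᵥ x < h m} := by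
  classical
  convert isOpen_strict (S.erase u) h using 2
  ext x
  simp only [Finset.mem_erase]
  exact ⟨fun H m hm => H m hm.2 hm.1, fun H m hm hne => H m ⟨hne, hm⟩⟩

theorem tightOnly_subset (hP : Presents P S h) {u : Fin (d + 1) → ℤ} :
    tightOnly S h u ⊆ P := fun x hx => (hP.mem_iff x).2 fun m hm => by
  by_cases hmu : m = u
  · rw [hmu]; exact hx.1.le
  · exact (hx.2 m hm hmu).le

/-- Near such a point `P` contains a full neighbourhood in the hyperplane of `u`, so the face spans
the whole kernel of `u`. -/
theorem isFacetNormal_of_mem_tightOnly (hP : Presents P S h) {u : Fin (d + 1) → ℤ} (hu : u ∈ S)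
    {x : Fin (d + 1) → ℝ} (hx : x ∈ tightOnly S h u) : IsFacetNormal P u := by
  obtain ⟨w, hw⟩ := hP.unimodular u hu
  refine ⟨isPrimitive_of_dotProduct_eq_one hw, ?_⟩
  have hface := hP.face_eq_of_tight hu (hP.tightOnly_subset hx) hx.1
  have hxf : x ∈ face P u := by rw [hface]; exact ⟨hP.tightOnly_subset hx, hx.1⟩
  suffices vectorSpan ℝ (face P u) = LinearMap.ker (dotLin (toR u)) by
    rw [this, finrank_ker_dotLin (toR_ne_zero (hP.ne_zero hu))]
  apply le_antisymm
  · rw [vectorSpan_def, Submodule.span_le]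
    rintro _ ⟨y, hy, z, hz, rfl⟩
    rw [hface] at hy hz
    simp [dotProduct_sub, hy.2, hz.2]
  · intro y hy
    have hy' : toR u ⬝ᵥ y = 0 := by simpa using hy
    have hc : Continuous fun t : ℝ => x + t • y := by fun_prop
    have h1 : ∀ᶠ t in nhds (0 : ℝ), x + t • y ∈ {x | ∀ m ∈ S, m ≠ u → toR m ⬝ᵥ x < h m} :=
      hc.continuousAt.eventually_mem ((isOpen_others S h u).mem_nhds (by simpa using hx.2))
    obtain ⟨t, ht, ht0⟩ := ((h1.filter_mono nhdsWithin_le_nhds).and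
      (self_mem_nhdsWithin (a := (0 : ℝ)) (s := Ioi 0))).exists
    have ht1 : x + t • y ∈ tightOnly S h u :=
      ⟨by rw [dotProduct_add, dotProduct_smul, hy', hx.1]; simp, ht⟩
    have h2 : t • y ∈ vectorSpan ℝ (face P u) := by
      have := vsub_mem_vectorSpan ℝ (p₁ := x + t • y) (p₂ := x) (s := face P u)
        (by rw [hface]; exact ⟨hP.tightOnly_subset ht1, ht1.1⟩) hxf
      simpa using this
    exact (Submodule.smul_mem_iff _ (ne_of_gt (mem_Ioi.1 ht0))).1 h2

/-- Turns relative interiors into strict inequalities. If a second inequality were tight at a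
relatively interior point, prolonging the segment from any `y` in the face slightly beyond that
point forces tightness at `y` too; then `eq_of_tight` identifies the two normals. -/
theorem faceInterior_eq (hP : Presents P S h) (hd : 1 ≤ d) {u : Fin (d + 1) → ℤ}
    (hu : IsFacetNormal P u) : faceInterior P u = tightOnly S h u := by
  have hface := hP.face_eq hd hu
  have huS := hP.mem_of_isFacetNormal hd hu
  have haff : ∀ y ∈ affineSpan ℝ (face P u), toR u ⬝ᵥ y = h u := by
    intro y hy
    refine affineSpan_induction (p := fun y => toR u ⬝ᵥ y = h u) hy ?_ ?_
    · intro z hz; rw [hface] at hz; exact hz.2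
    · intro c a b e ha hb he
      simp only [vsub_eq_sub, vadd_eq_add, dotProduct_add, dotProduct_smul, dotProduct_sub, ha, hb,
        he, sub_self, smul_zero, zero_add]
  apply Subset.antisymm
  · intro x hx
    have hxf := intrinsicInterior_subset hx
    refine ⟨by rw [hface] at hxf; exact hxf.2, fun m hm hne => ?_⟩
    refine lt_of_le_of_ne ((hP.mem_iff x).1 hxf.1 m hm) fun he => hne ?_
    refine (hP.eq_of_tight hd hu hm fun y hy => ?_).symm
    refine le_antisymm ((hP.mem_iff y).1 hy.1 m hm) ?_
    obtain ⟨x', hx', rfl⟩ := mem_intrinsicInterior.1 hx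
    have hya := subset_affineSpan ℝ _ hy
    let f : ℝ → affineSpan ℝ (face P u) := fun t =>
      ⟨AffineMap.lineMap (x' : Fin (d + 1) → ℝ) y t, AffineMap.lineMap_mem t x'.2 hya⟩
    have hf : Continuous f := Continuous.subtype_mk AffineMap.lineMap_continuous _
    have h1 : ∀ᶠ t in nhds (0 : ℝ), f t ∈ interior ((↑) ⁻¹' face P u) :=
      hf.continuousAt.eventually_mem (isOpen_interior.mem_nhds (by
        have : f 0 = x' := by ext; simp [f]
        rw [this]; exact hx'))
    obtain ⟨t, ht, ht0⟩ := ((h1.filter_mono nhdsWithin_le_nhds).and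
      (self_mem_nhdsWithin (a := (0 : ℝ)) (s := Iio 0))).exists
    have h2 : (f t : Fin (d + 1) → ℝ) ∈ face P u :=
      interior_subset (s := ((↑) : affineSpan ℝ (face P u) → _) ⁻¹' face P u) ht
    have h3 := (hP.mem_iff _).1 h2.1 m hm
    simp only [f, AffineMap.lineMap_apply, vsub_eq_sub, vadd_eq_add, dotProduct_add,
      dotProduct_smul, dotProduct_sub, smul_eq_mul, he] at h3
    have ht0' : t < 0 := ht0
    nlinarith
  · intro x hx
    have hxf : x ∈ face P u := by rw [hface]; exact ⟨hP.tightOnly_subset hx, hx.1⟩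
    refine mem_intrinsicInterior.2 ⟨⟨x, subset_affineSpan ℝ _ hxf⟩, ?_, rfl⟩
    rw [mem_interior]
    refine ⟨(Subtype.val : affineSpan ℝ (face P u) → _) ⁻¹' {x | ∀ m ∈ S, m ≠ u → toR m ⬝ᵥ x < h m}, fun z hz => ?_,
      (isOpen_others S h u).preimage continuous_subtype_val, mem_preimage.2 hx.2⟩
    have hz1 : (z : Fin (d + 1) → ℝ) ∈ tightOnly S h u := ⟨haff z z.2, hz⟩
    exact hface.ge ⟨hP.tightOnly_subset hz1, hz1.1⟩

end Presents

/-! ### Generic rays and the existence of facets -/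

theorem volume_hyperplane_eq_zero {n : ℕ} {a : Fin n → ℝ} (ha : a ≠ 0) (c : ℝ) :
    volume {x : Fin n → ℝ | a ⬝ᵥ x = c} = 0 := by
  have key : volume ((LinearMap.ker (dotLin a) : Submodule ℝ (Fin n → ℝ)) : Set (Fin n → ℝ)) = 0 :=
    Measure.addHaar_submodule _ _ fun h => dotLin_ne_zero ha (LinearMap.ker_eq_top.1 h)
  rcases eq_empty_or_nonempty {x : Fin n → ℝ | a ⬝ᵥ x = c} with h | ⟨x₀, hx₀⟩
  · rw [h, measure_empty]
  · rw [← measure_preimage_add_right volume x₀]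
    refine measure_mono_null (fun x hx => ?_) key
    have h1 : a ⬝ᵥ (x + x₀) = c := hx
    have h2 : a ⬝ᵥ x₀ = c := hx₀
    rw [dotProduct_add, h2] at h1
    simpa using h1

namespace Presents

variable {P : Set (Fin (d + 1) → ℝ)} {S : Finset (Fin (d + 1) → ℤ)} {h : (Fin (d + 1) → ℤ) → ℝ}

theorem combination_ne_zero (hP : Presents P S h) {m m' : Fin (d + 1) → ℤ} (hm : m ∈ S)
    (hm' : m' ∈ S) (hne : m ≠ m') : h m' • toR m - h m • toR m' ≠ 0 := by
  intro h0
  obtain ⟨w, hw⟩ := hP.unimodular m hm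
  obtain ⟨w', hw'⟩ := hP.unimodular m' hm'
  refine hne (eq_of_smul_eq hw hw' (c := h m' / h m) (div_pos (hP.pos _ hm') (hP.pos _ hm)) ?_).symm
  have := hP.pos m hm
  rw [sub_eq_zero] at h0
  rw [div_eq_inv_mul, mul_smul, h0, smul_smul, inv_mul_cancel₀ this.ne', one_smul]

theorem gauge_pos (hP : Presents P S h) {x : Fin (d + 1) → ℝ} (hx : x ≠ 0) : 0 < gauge P x :=
  (_root_.gauge_pos (absorbent_nhds_zero hP.mem_nhds_zero)
    ((NormedSpace.isVonNBounded_iff ℝ).2 hP.bounded)).2 hx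

theorem inv_gauge_smul_mem_frontier (hP : Presents P S h) {x : Fin (d + 1) → ℝ} (hx : x ≠ 0) :
    (gauge P x)⁻¹ • x ∈ frontier P := by
  have h0 := hP.gauge_pos hx
  rw [← gauge_eq_one_iff_mem_frontier hP.convex hP.mem_nhds_zero,
    gauge_smul_of_nonneg (inv_nonneg.2 h0.le), smul_eq_mul, inv_mul_cancel₀ h0.ne']

/-- Rays leaving `P` through two bounding hyperplanes at once lie in finitely many proper
hyperplanes. These are null sets and cannot cover a nonempty open set. -/
theorem exists_smul_mem_tightOnly (hP : Presents P S h) {O : Set (Fin (d + 1) → ℝ)}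
    (hO : IsOpen O) (hne : O.Nonempty) :
    ∃ x ∈ O, ∃ u ∈ S, ∃ t : ℝ, 0 < t ∧ t • x ∈ tightOnly S h u := by
  classical
  have hnull : volume (({0} : Set (Fin (d + 1) → ℝ)) ∪ ⋃ p ∈ S.offDiag,
      {x : Fin (d + 1) → ℝ | (h p.2 • toR p.1 - h p.1 • toR p.2) ⬝ᵥ x = 0}) = 0 := by
    refine measure_union_null (by simp) ?_
    refine (measure_biUnion_null_iff (Finset.countable_toSet S.offDiag)).2 fun p hp => ?_
    obtain ⟨h1, h2, h3⟩ := Finset.mem_offDiag.1 (Finset.mem_coe.1 hp)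
    exact volume_hyperplane_eq_zero (hP.combination_ne_zero h1 h2 h3) 0
  obtain ⟨x, hxO, hx⟩ : ∃ x ∈ O, x ∉ (({0} : Set (Fin (d + 1) → ℝ)) ∪ ⋃ p ∈ S.offDiag,
      {x : Fin (d + 1) → ℝ | (h p.2 • toR p.1 - h p.1 • toR p.2) ⬝ᵥ x = 0}) := by
    by_contra hcon
    push Not at hcon
    exact (hO.measure_pos volume hne).ne' (measure_mono_null hcon hnull)
  simp only [mem_union, mem_singleton_iff, mem_iUnion, not_or, not_exists] at hx
  have ht := inv_pos.2 (hP.gauge_pos hx.1)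
  obtain ⟨hxP, u, hu, htu⟩ := hP.mem_frontier_iff.1 (hP.inv_gauge_smul_mem_frontier hx.1)
  refine ⟨x, hxO, u, hu, _, ht, htu, fun m hm hmu => lt_of_le_of_ne ((hP.mem_iff _).1 hxP m hm)
    fun he => hx.2 (u, m) (Finset.mem_offDiag.2 ⟨hu, hm, hmu.symm⟩) ?_⟩
  set t := (gauge P x)⁻¹
  change (h m • toR u - h u • toR m) ⬝ᵥ x = 0
  rw [dotProduct_smul] at htu he
  rw [sub_dotProduct, smul_dotProduct, smul_dotProduct, ← htu, ← he]
  simp only [smul_eq_mul]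
  ring

/-- Perturb `a` to a generic `x` without changing the sign of any negative pairing. The facet
through which the ray of `x` leaves pairs positively with `x`, hence not negatively with `a`. Taking
`a` opposite to a given vector later produces a facet outside a given class. -/
theorem exists_tightOnly_nonneg (hP : Presents P S h) (a : Fin (d + 1) → ℝ) :
    ∃ u ∈ S, (tightOnly S h u).Nonempty ∧ 0 ≤ toR u ⬝ᵥ a := by
  classical
  have hO : IsOpen {x : Fin (d + 1) → ℝ | ∀ m ∈ S.filter (fun m => toR m ⬝ᵥ a < 0),
      toR m ⬝ᵥ x < 0} := isOpen_strict _ fun _ => 0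
  obtain ⟨x, hx, u, hu, t, ht, hxt⟩ := hP.exists_smul_mem_tightOnly hO
    ⟨a, fun m hm => (Finset.mem_filter.1 hm).2⟩
  refine ⟨u, hu, ⟨_, hxt⟩, ?_⟩
  by_contra hneg
  have h1 := hx u (Finset.mem_filter.2 ⟨hu, not_le.1 hneg⟩)
  have h2 := hxt.1
  rw [dotProduct_smul, smul_eq_mul] at h2
  have h3 := hP.pos u hu
  nlinarith

theorem tightOnly_disjoint {u u' : Fin (d + 1) → ℤ} (hu : u ∈ S) (hne : u ≠ u') :
    Disjoint (tightOnly S h u) (tightOnly S h u') := by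
  rw [Set.disjoint_left]
  intro x hx hx'
  exact (hx'.2 u hu hne).ne hx.1

theorem measurableSet_tightOnly (u : Fin (d + 1) → ℤ) : MeasurableSet (tightOnly S h u) :=
  (isClosed_eq (continuous_dotProduct_left _) continuous_const).measurableSet.inter
    (isOpen_others S h u).measurableSet

end Presents

/-! ### Bases of `u^⊥` and their duals -/

/-- Since `⟨u, w⟩ = 1`, the lattice splits as `ℤw ⊕ u^⊥`; the `β j` are the coordinates of the
projection `π` onto `u^⊥` along `w`. -/
theorem exists_dual_basis {u w : Fin (d + 1) → ℤ} (huw : u ⬝ᵥ w = 1) :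
    ∃ β : Fin (Module.finrank ℤ (perp u)) → Fin (d + 1) → ℤ, (∀ j, β j ⬝ᵥ w = 0) ∧
      (∀ j l, β j ⬝ᵥ (Module.finBasis ℤ (perp u) l : Fin (d + 1) → ℤ) = if l = j then 1 else 0) ∧
      ∀ z : Fin (d + 1) → ℤ, z = (u ⬝ᵥ z) • w +
        ∑ j, (β j ⬝ᵥ z) • (Module.finBasis ℤ (perp u) j : Fin (d + 1) → ℤ) := by
  classical
  let b := Module.finBasis ℤ (perp u)
  let π : (Fin (d + 1) → ℤ) →ₗ[ℤ] perp u :=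
    { toFun := fun z => ⟨z - (u ⬝ᵥ z) • w, by
        change u ⬝ᵥ (z - (u ⬝ᵥ z) • w) = 0
        rw [dotProduct_sub, dotProduct_smul, huw]; simp⟩
      map_add' := fun x y => by
        ext i; simp [dotProduct_add, add_mul]; ring
      map_smul' := fun c x => by
        ext i; simp [dotProduct_smul, -zsmul_eq_mul]; ring }
  have hdual : ∀ j, ∃ β : Fin (d + 1) → ℤ, ∀ z, β ⬝ᵥ z = b.repr (π z) j := by
    intro j
    refine ⟨fun i => b.repr (π fun k => if i = k then 1 else 0) j, fun z => ?_⟩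
    have := LinearMap.pi_apply_eq_sum_univ (b.coord j ∘ₗ π) z
    simp only [LinearMap.comp_apply, Module.Basis.coord_apply, smul_eq_mul] at this
    rw [this, dotProduct]
    exact Finset.sum_congr rfl fun i _ => mul_comm _ _
  choose β hβ using hdual
  refine ⟨β, fun j => ?_, fun j l => ?_, fun z => ?_⟩
  · have : π w = 0 := by ext i; simp [π, huw]
    rw [hβ, this]; simp
  · have : π (b l : Fin (d + 1) → ℤ) = b l := by
      ext i
      have : u ⬝ᵥ (b l : Fin (d + 1) → ℤ) = 0 := (b l).2
      simp [π, this]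
    change β j ⬝ᵥ (b l : Fin (d + 1) → ℤ) = _
    rw [hβ, this, Module.Basis.repr_self, Finsupp.single_apply]
  · have h1 := congrArg (Subtype.val : perp u → _) (b.sum_repr (π z))
    simp only [hβ]
    rw [Submodule.coe_sum] at h1
    simp only [Submodule.coe_smul] at h1
    rw [h1]
    change z = (u ⬝ᵥ z) • w + (z - (u ⬝ᵥ z) • w)
    abel

theorem toR_sum {ι : Type*} (s : Finset ι) (f : ι → Fin (d + 1) → ℤ) :
    toR (∑ j ∈ s, f j) = ∑ j ∈ s, toR (f j) := by
  funext i; simp [toR]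

theorem finrank_perp {u w : Fin (d + 1) → ℤ} (huw : u ⬝ᵥ w = 1) :
    Module.finrank ℤ (perp u) = d := by
  let e : (Fin (d + 1) → ℤ) ≃ₗ[ℤ] perp u × ℤ :=
    { toFun := fun z => (⟨z - (u ⬝ᵥ z) • w, by
        change u ⬝ᵥ (z - (u ⬝ᵥ z) • w) = 0
        rw [dotProduct_sub, dotProduct_smul, huw]; simp⟩, u ⬝ᵥ z)
      invFun := fun p => p.1 + p.2 • w
      map_add' := fun x y => by
        ext i
        · simp [dotProduct_add, add_mul]; ring
        · simp [dotProduct_add]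
      map_smul' := fun c x => by
        ext i
        · simp [dotProduct_smul, -zsmul_eq_mul]; ring
        · simp [dotProduct_smul, -zsmul_eq_mul]
      left_inv := fun z => by simp
      right_inv := fun p => by
        have hp : u ⬝ᵥ (p.1 : Fin (d + 1) → ℤ) = 0 := p.1.2
        ext i
        · simp [dotProduct_add, dotProduct_smul, huw, hp, -zsmul_eq_mul]
        · simp [dotProduct_add, dotProduct_smul, huw, hp, -zsmul_eq_mul] }
  have := e.finrank_eq
  rw [Module.finrank_prod] at this
  simp at this
  omega

/-- Both sides are linear in `x`, so the integral identity at the standard basis vectors suffices.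
-/
theorem eq_add_sum_of_dual {u w : Fin (d + 1) → ℤ} {k : ℕ} {β b : Fin k → Fin (d + 1) → ℤ}
    (hz : ∀ z : Fin (d + 1) → ℤ, z = (u ⬝ᵥ z) • w + ∑ j, (β j ⬝ᵥ z) • b j)
    (x : Fin (d + 1) → ℝ) :
    x = (toR u ⬝ᵥ x) • toR w + ∑ j, (toR (β j) ⬝ᵥ x) • toR (b j) := by
  classical
  let f : (Fin (d + 1) → ℝ) →ₗ[ℝ] (Fin (d + 1) → ℝ) :=
    (dotLin (toR u)).smulRight (toR w) + ∑ j, (dotLin (toR (β j))).smulRight (toR (b j))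
  suffices LinearMap.id = f by simpa [f] using LinearMap.congr_fun this x
  refine (Pi.basisFun ℝ (Fin (d + 1))).ext fun i => ?_
  have h1 := congrArg toR (hz (Pi.single i 1))
  have h2 : (Pi.single i 1 : Fin (d + 1) → ℝ) = toR (Pi.single i 1) := by
    funext l; by_cases hl : l = i
    · subst hl; simp [toR]
    · simp [toR, hl]
  simp only [Pi.basisFun_apply, LinearMap.id_apply]
  rw [h2]
  simp only [f, LinearMap.add_apply, LinearMap.smulRight_apply, dotLin_apply,
    LinearMap.sum_apply, toR_dotProduct_toR]
  conv_lhs => rw [h1]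
  simp [toR_add, toR_smul, toR_sum, -zsmul_eq_mul]

section Param

variable {P : Set (Fin (d + 1) → ℝ)} {u : Fin (d + 1) → ℤ}

theorem dotProduct_param_perp (P : Set (Fin (d + 1) → ℝ)) (u : Fin (d + 1) → ℤ)
    (y : Fin (Module.finrank ℤ (perp u)) → ℝ) :
    toR u ⬝ᵥ param P u y = toR u ⬝ᵥ basePoint P u := by
  have : ∀ j, toR u ⬝ᵥ toR (Module.finBasis ℤ (perp u) j : Fin (d + 1) → ℤ) = 0 := fun j => by
    rw [toR_dotProduct_toR]
    have : u ⬝ᵥ (Module.finBasis ℤ (perp u) j : Fin (d + 1) → ℤ) = 0 :=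
      (Module.finBasis ℤ (perp u) j).2
    rw [this]; simp
  rw [param, dotProduct_add, dotProduct_sum]
  simp [dotProduct_smul, this]

theorem dotProduct_basePoint (hu : u ≠ 0) :
    toR u ⬝ᵥ basePoint P u = sSup ((fun x => toR u ⬝ᵥ x) '' P) := by
  have := dotProduct_self_pos (toR_ne_zero hu)
  rw [basePoint, dotProduct_smul, smul_eq_mul, div_mul_cancel₀ _ this.ne']

theorem continuous_param : Continuous (param P u) := by
  unfold param; fun_prop

theorem exists_leftInverse_param {w : Fin (d + 1) → ℤ} (huw : u ⬝ᵥ w = 1) :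
    ∃ g : (Fin (d + 1) → ℝ) → (Fin (Module.finrank ℤ (perp u)) → ℝ), Continuous g ∧
      Function.LeftInverse g (param P u) ∧
      ∀ x, toR u ⬝ᵥ x = toR u ⬝ᵥ basePoint P u → param P u (g x) = x := by
  obtain ⟨β, -, hβb, hz⟩ := exists_dual_basis huw
  refine ⟨fun x j => toR (β j) ⬝ᵥ (x - basePoint P u), ?_, fun y => ?_, fun x hx => ?_⟩
  · unfold dotProduct; fun_prop
  · funext j
    simp only [param, add_sub_cancel_left, dotProduct_sum, dotProduct_smul, toR_dotProduct_toR, hβb]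
    simp
  · have := eq_add_sum_of_dual hz (x - basePoint P u)
    rw [dotProduct_sub, hx, sub_self, zero_smul, zero_add] at this
    rw [param, ← this]; abel

theorem isClosedEmbedding_param {w : Fin (d + 1) → ℤ} (huw : u ⬝ᵥ w = 1) :
    Topology.IsClosedEmbedding (param P u) := by
  obtain ⟨g, hg, hl, -⟩ := exists_leftInverse_param (P := P) huw
  exact hl.isClosedEmbedding hg continuous_param

end Param

/-! ### The integral measure of a presented polytope -/

namespace Presents

variable {P : Set (Fin (d + 1) → ℝ)} {S : Finset (Fin (d + 1) → ℤ)} {h : (Fin (d + 1) → ℤ) → ℝ}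

theorem exists_pairing (hP : Presents P S h) {m : Fin (d + 1) → ℤ} (hm : m ∈ S) :
    ∃ w : Fin (d + 1) → ℤ, m ⬝ᵥ w = 1 := by
  obtain ⟨w, hw⟩ := hP.unimodular m hm
  exact ⟨w, by rw [dotProduct_comm, hw]⟩

theorem dotProduct_param (hP : Presents P S h) (hd : 1 ≤ d) {u : Fin (d + 1) → ℤ}
    (hu : IsFacetNormal P u) (y) : toR u ⬝ᵥ param P u y = h u := by
  obtain ⟨x₀, hx₀⟩ := nonempty_of_isFacetNormal hd hu
  have huS := hP.mem_of_isFacetNormal hd hu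
  rw [hP.face_eq hd hu] at hx₀
  rw [dotProduct_param_perp, dotProduct_basePoint (hP.ne_zero huS),
    hP.sSup_eq_of_tight huS hx₀.1 hx₀.2]

theorem exists_param_eq (hP : Presents P S h) (hd : 1 ≤ d) {u : Fin (d + 1) → ℤ}
    (hu : IsFacetNormal P u) {x : Fin (d + 1) → ℝ} (hx : toR u ⬝ᵥ x = h u) :
    ∃ y, param P u y = x := by
  obtain ⟨w, hw⟩ := hP.exists_pairing (hP.mem_of_isFacetNormal hd hu)
  obtain ⟨g, -, -, hg⟩ := exists_leftInverse_param (P := P) hw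
  exact ⟨g x, hg x (by rw [← dotProduct_param_perp P u 0, hP.dotProduct_param hd hu, hx])⟩

theorem measurableSet_faceInterior (hP : Presents P S h) (hd : 1 ≤ d) {u : Fin (d + 1) → ℤ}
    (hu : IsFacetNormal P u) : MeasurableSet (faceInterior P u) := by
  rw [hP.faceInterior_eq hd hu]; exact measurableSet_tightOnly u

theorem finite_facets (hP : Presents P S h) (hd : 1 ≤ d) :
    Finite {u : Fin (d + 1) → ℤ // IsFacetNormal P u} :=
  (S.finite_toSet.subset fun _ hu => hP.mem_of_isFacetNormal hd hu).to_subtype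

/-- Holds for every `X`, measurable or not, because the sum is countable, the open facets are
measurable and `param` is a measurable embedding. It will be used for transports of arbitrary
measurable sets. -/
theorem integralMeasure_apply (hP : Presents P S h) (hd : 1 ≤ d) (X : Set (Fin (d + 1) → ℝ)) :
    integralMeasure P X = ∑' u : {u : Fin (d + 1) → ℤ // IsFacetNormal P u},
      volume (param P u.1 ⁻¹' (X ∩ faceInterior P u.1)) := by
  rw [integralMeasure, Measure.sum_apply_of_countable]
  refine tsum_congr fun u => ?_
  obtain ⟨w, hw⟩ := hP.exists_pairing (hP.mem_of_isFacetNormal hd u.2)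
  rw [Measure.restrict_apply' (hP.measurableSet_faceInterior hd u.2),
    (isClosedEmbedding_param hw).measurableEmbedding.map_apply]

theorem faceInterior_disjoint (hP : Presents P S h) (hd : 1 ≤ d) {u u' : Fin (d + 1) → ℤ}
    (hu : IsFacetNormal P u) (hu' : IsFacetNormal P u') (hne : u ≠ u') :
    Disjoint (faceInterior P u) (faceInterior P u') := by
  rw [hP.faceInterior_eq hd hu, hP.faceInterior_eq hd hu']
  exact tightOnly_disjoint (hP.mem_of_isFacetNormal hd hu) hne

theorem integralMeasure_eq_volume (hP : Presents P S h) (hd : 1 ≤ d) {u : Fin (d + 1) → ℤ}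
    (hu : IsFacetNormal P u) {X : Set (Fin (d + 1) → ℝ)} (hX : X ⊆ faceInterior P u) :
    integralMeasure P X = volume (param P u ⁻¹' X) := by
  rw [hP.integralMeasure_apply hd, tsum_eq_single ⟨u, hu⟩]
  · rw [inter_eq_left.2 hX]
  · intro u' hne
    have : X ∩ faceInterior P u'.1 = ∅ := by
      rw [← disjoint_iff_inter_eq_empty]
      exact (hP.faceInterior_disjoint hd hu u'.2 fun he => hne (Subtype.ext he.symm)).mono_left hX
    rw [this]; simp

theorem integralMeasure_inter_openFacets (hP : Presents P S h) (hd : 1 ≤ d)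
    (X : Set (Fin (d + 1) → ℝ)) :
    integralMeasure P (X ∩ openFacets P) = integralMeasure P X := by
  rw [hP.integralMeasure_apply hd, hP.integralMeasure_apply hd]
  refine tsum_congr fun u => ?_
  have : faceInterior P u.1 ⊆ openFacets P :=
    fun x hx => mem_iUnion₂.2 ⟨u.1, u.2, hx⟩
  rw [inter_assoc, inter_eq_right.2 this]

theorem integralMeasure_mono_openFacets (hP : Presents P S h) (hd : 1 ≤ d)
    {X Y : Set (Fin (d + 1) → ℝ)} (hXY : X ∩ openFacets P ⊆ Y) :
    integralMeasure P X ≤ integralMeasure P Y := by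
  rw [← hP.integralMeasure_inter_openFacets hd X]
  exact measure_mono hXY

theorem integralMeasure_univ_lt_top (hP : Presents P S h) (hd : 1 ≤ d) :
    integralMeasure P univ < ∞ := by
  have := hP.finite_facets hd
  have := Fintype.ofFinite {u : Fin (d + 1) → ℤ // IsFacetNormal P u}
  rw [hP.integralMeasure_apply hd, tsum_fintype]
  refine ENNReal.sum_lt_top.2 fun u _ => ?_
  obtain ⟨w, hw⟩ := hP.exists_pairing (hP.mem_of_isFacetNormal hd u.2)
  refine lt_of_le_of_lt (measure_mono (preimage_mono (t := P) ?_))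
    ((isClosedEmbedding_param hw).isCompact_preimage hP.isCompact).measure_lt_top
  rw [univ_inter, hP.faceInterior_eq hd u.2]
  exact hP.tightOnly_subset

theorem integralMeasure_pos (hP : Presents P S h) (hd : 1 ≤ d) {u : Fin (d + 1) → ℤ}
    (hu : IsFacetNormal P u) {O : Set (Fin (d + 1) → ℝ)} (hO : IsOpen O)
    (hne : (faceInterior P u ∩ O).Nonempty) : 0 < integralMeasure P (faceInterior P u ∩ O) := by
  rw [hP.integralMeasure_eq_volume hd hu inter_subset_left]
  rw [hP.faceInterior_eq hd hu] at hne ⊢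
  obtain ⟨x, hx, hxO⟩ := hne
  obtain ⟨y, rfl⟩ := hP.exists_param_eq hd hu hx.1
  have : param P u ⁻¹' (tightOnly S h u ∩ O) =
      param P u ⁻¹' ({x | ∀ m ∈ S, m ≠ u → toR m ⬝ᵥ x < h m} ∩ O) := by
    ext z
    exact ⟨fun hz => ⟨hz.1.2, hz.2⟩, fun hz => ⟨⟨hP.dotProduct_param hd hu z, hz.1⟩, hz.2⟩⟩
  rw [this]
  exact (((isOpen_others S h u).inter hO).preimage continuous_param).measure_pos _ ⟨y, hx.2, hxO⟩

theorem faceInterior_subset_frontier (hP : Presents P S h) (hd : 1 ≤ d) {u : Fin (d + 1) → ℤ}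
    (hu : IsFacetNormal P u) : faceInterior P u ⊆ frontier P := by
  rw [hP.faceInterior_eq hd hu]
  exact fun x hx => hP.mem_frontier_iff.2
    ⟨hP.tightOnly_subset hx, u, hP.mem_of_isFacetNormal hd hu, hx.1⟩

theorem openFacets_subset_frontier (hP : Presents P S h) (hd : 1 ≤ d) :
    openFacets P ⊆ frontier P :=
  iUnion₂_subset fun _ hu => hP.faceInterior_subset_frontier hd hu

theorem exists_facet_nonneg (hP : Presents P S h) (hd : 1 ≤ d) (a : Fin (d + 1) → ℝ) :
    ∃ u, IsFacetNormal P u ∧ (faceInterior P u).Nonempty ∧ 0 ≤ toR u ⬝ᵥ a := by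
  obtain ⟨u, hu, ⟨x, hx⟩, h0⟩ := hP.exists_tightOnly_nonneg a
  have hf := hP.isFacetNormal_of_mem_tightOnly hu hx
  exact ⟨u, hf, by rw [hP.faceInterior_eq hd hf]; exact ⟨x, hx⟩, h0⟩

theorem faceInterior_nonempty (hP : Presents P S h) {u : Fin (d + 1) → ℤ}
    (hd : 1 ≤ d) (hu : IsFacetNormal P u) : (faceInterior P u).Nonempty :=
  (nonempty_of_isFacetNormal hd hu).intrinsicInterior <| by
    rw [hP.face_eq hd hu]
    exact hP.convex.inter (convex_hyperplane (dotLin (toR u)).isLinear _)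

theorem integralMeasure_frontier_pos (hP : Presents P S h) (hd : 1 ≤ d) :
    0 < integralMeasure P (frontier P) := by
  obtain ⟨u, hu, hne, -⟩ := hP.exists_facet_nonneg hd 0
  have := hP.integralMeasure_pos hd hu isOpen_univ (by simpa using hne)
  rw [inter_univ] at this
  exact this.trans_le (measure_mono (hP.faceInterior_subset_frontier hd hu))

/-- The measure is carried by the open facets, so a closed facet has no more mass than its relative
interior. -/
theorem face_inter_openFacets (hP : Presents P S h) (hd : 1 ≤ d) {u : Fin (d + 1) → ℤ}
    (hu : IsFacetNormal P u) : face P u ∩ openFacets P ⊆ faceInterior P u := by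
  rintro x ⟨hx, hxo⟩
  obtain ⟨u', hu', hxu'⟩ := mem_iUnion₂.1 hxo
  by_cases hne : u = u'
  · rwa [hne]
  · rw [hP.faceInterior_eq hd hu'] at hxu'
    rw [hP.face_eq hd hu] at hx
    exact absurd hx.2 (hxu'.2 u (hP.mem_of_isFacetNormal hd hu) hne).ne

end Presents

/-! ### Reflexive polytopes -/

theorem exists_dotProduct_eq {n : ℕ} (f : StrongDual ℝ (Fin n → ℝ)) :
    ∃ a : Fin n → ℝ, ∀ x, f x = a ⬝ᵥ x := by
  refine ⟨fun i => f fun j => if i = j then 1 else 0, fun x => ?_⟩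
  have := LinearMap.pi_apply_eq_sum_univ (f : (Fin n → ℝ) →ₗ[ℝ] ℝ) x
  simp only [ContinuousLinearMap.coe_coe, smul_eq_mul] at this
  rw [this, dotProduct]
  exact Finset.sum_congr rfl fun i _ => mul_comm _ _

theorem IsLatticePolytope.isCompact {P : Set (Fin (d + 1) → ℝ)} (hP : IsLatticePolytope P) :
    IsCompact P := by
  obtain ⟨S, rfl⟩ := hP
  exact (S.finite_toSet.image _).isCompact_convexHull ℝ

theorem IsLatticePolytope.convex {P : Set (Fin (d + 1) → ℝ)} (hP : IsLatticePolytope P) :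
    Convex ℝ P := by
  obtain ⟨S, rfl⟩ := hP
  exact convex_convexHull _ _

theorem dotProduct_le_of_mem_convexHull {S : Finset (Fin (d + 1) → ℤ)} {a : Fin (d + 1) → ℝ}
    {c : ℝ} (h : ∀ m ∈ S, a ⬝ᵥ toR m ≤ c) {x : Fin (d + 1) → ℝ}
    (hx : x ∈ convexHull ℝ (toR '' (S : Set (Fin (d + 1) → ℤ)))) : a ⬝ᵥ x ≤ c := by
  refine convexHull_min (t := {x | a ⬝ᵥ x ≤ c}) ?_ (convex_halfSpace_le (dotLin a).isLinear c) hx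
  rintro _ ⟨m, hm, rfl⟩
  exact h m hm

theorem not_isBounded_of_ray {Q : Set (Fin (d + 1) → ℝ)} {a : Fin (d + 1) → ℝ} (ha : a ≠ 0)
    (h : ∀ t : ℝ, 0 ≤ t → t • a ∈ Q) : ¬ Bornology.IsBounded Q := by
  intro hb
  obtain ⟨C, hC0, hC⟩ := hb.exists_pos_norm_le
  have ha' := norm_pos_iff.2 ha
  have := hC _ (h ((C + 1) / ‖a‖) (by positivity))
  rw [norm_smul, Real.norm_of_nonneg (by positivity), div_mul_cancel₀ _ ha'.ne'] at this
  linarith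

/-- A functional separating `0` from `Δ` is negative on `Δ`, so its whole ray lies in the dual,
which is bounded. If `Δ` is empty the dual is the whole space. -/
theorem IsReflexive.zero_mem {Δ : Set (Fin (d + 1) → ℝ)} (hΔ : IsReflexive Δ) : 0 ∈ Δ := by
  by_contra h0
  obtain ⟨f, c, hf, hc⟩ := geometric_hahn_banach_closed_point hΔ.1.convex
    hΔ.1.isCompact.isClosed h0
  obtain ⟨a, ha⟩ := exists_dotProduct_eq f
  simp only [ha, dotProduct_zero] at hf hc
  rcases eq_empty_or_nonempty Δ with he | ⟨x₀, hx₀⟩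
  · refine not_isBounded_of_ray (a := fun _ => (1 : ℝ))
      (fun h => by simpa using congrFun h 0) (fun t _ => ?_) hΔ.2.isCompact.isBounded
    intro m hm
    simp [he] at hm
  · refine not_isBounded_of_ray (a := a) ?_ (fun t ht => ?_) hΔ.2.isCompact.isBounded
    · rintro rfl
      have := hf x₀ hx₀
      rw [zero_dotProduct] at this
      linarith
    · intro m hm
      have := hf m hm
      rw [dotProduct_smul, dotProduct_comm, smul_eq_mul]
      nlinarith

/-- The bipolar theorem: `0 ∈ Δ` makes the separating constant `c` positive, and dividing by it puts
the functional in the dual. -/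
theorem IsReflexive.mem_of_forall_dual {Δ : Set (Fin (d + 1) → ℝ)} (hΔ : IsReflexive Δ)
    {x : Fin (d + 1) → ℝ} (hx : ∀ n ∈ dualPolytope Δ, x ⬝ᵥ n ≤ 1) : x ∈ Δ := by
  by_contra h0
  obtain ⟨f, c, hf, hc⟩ := geometric_hahn_banach_closed_point hΔ.1.convex
    hΔ.1.isCompact.isClosed h0
  obtain ⟨a, ha⟩ := exists_dotProduct_eq f
  simp only [ha] at hf hc
  have hc0 : 0 < c := by simpa using hf 0 hΔ.zero_mem
  have h1 := hx (c⁻¹ • a) fun m hm => by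
    rw [dotProduct_smul, dotProduct_comm, smul_eq_mul, inv_mul_le_iff₀ hc0, mul_one]
    exact (hf m hm).le
  rw [dotProduct_smul, dotProduct_comm, smul_eq_mul, inv_mul_le_iff₀ hc0] at h1
  linarith

/-- The inequalities come from the nonzero generators of the dual. An integral pairing bounded by 1
and different from 1 is at most 0. So if a nonzero generator of one polytope, or a nonzero lattice
point of `Δ`, never paired to 1 with the generators of the other, its ray would stay in a bounded
polytope. -/
theorem IsReflexive.exists_presents {Δ : Set (Fin (d + 1) → ℝ)} (hΔ : IsReflexive Δ) :
    ∃ S, Presents Δ S (fun _ => 1) ∧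
      ∀ m : Fin (d + 1) → ℤ, toR m ∈ Δ → m ≠ 0 → ∃ v ∈ S, v ⬝ᵥ m = 1 := by
  classical
  obtain ⟨S₁, hS₁⟩ := hΔ.1
  obtain ⟨S₂, hS₂⟩ := hΔ.2
  have hmem₁ : ∀ m ∈ S₁, toR m ∈ Δ := fun m hm => by
    rw [hS₁]; exact subset_convexHull ℝ _ ⟨m, hm, rfl⟩
  have hmem₂ : ∀ v ∈ S₂, toR v ∈ dualPolytope Δ := fun m hm => by
    rw [hS₂]; exact subset_convexHull ℝ _ ⟨m, hm, rfl⟩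
  have hint : ∀ a b : Fin (d + 1) → ℤ, toR a ⬝ᵥ toR b ≤ 1 → a ⬝ᵥ b ≠ 1 → toR a ⬝ᵥ toR b ≤ 0 := by
    intro a b h1 h2
    rw [toR_dotProduct_toR] at h1 ⊢
    have : a ⬝ᵥ b ≤ 1 := by exact_mod_cast h1
    have : a ⬝ᵥ b ≤ 0 := by omega
    exact_mod_cast this
  refine ⟨S₂.erase 0, ⟨fun x => ⟨fun hx v hv => ?_, fun hx => ?_⟩, fun _ _ => one_pos,
    fun v hv => ?_, hΔ.1.isCompact.isBounded⟩, fun m hm hm0 => ?_⟩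
  · rw [dotProduct_comm]
    exact hmem₂ v (Finset.mem_of_mem_erase hv) x hx
  · refine hΔ.mem_of_forall_dual fun n hn => ?_
    rw [hS₂] at hn
    refine dotProduct_le_of_mem_convexHull (fun v hv => ?_) hn
    by_cases hv0 : v = 0
    · simp [hv0, toR_zero]
    · rw [dotProduct_comm]; exact hx v (Finset.mem_erase.2 ⟨hv0, hv⟩)
  · obtain ⟨hv0, hv⟩ := Finset.mem_erase.1 hv
    by_contra hcon
    push Not at hcon
    refine not_isBounded_of_ray (toR_ne_zero hv0) (fun t ht => ?_) hΔ.2.isCompact.isBounded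
    intro x hx
    have h1 : toR v ⬝ᵥ x ≤ 0 := by
      rw [hS₁] at hx
      refine dotProduct_le_of_mem_convexHull (fun m hm => ?_) hx
      rw [dotProduct_comm]
      exact hint m v (hmem₂ v hv _ (hmem₁ m hm)) (hcon m)
    rw [dotProduct_smul, dotProduct_comm, smul_eq_mul]
    nlinarith
  · by_contra hcon
    push Not at hcon
    refine not_isBounded_of_ray (toR_ne_zero hm0) (fun t ht => ?_) hΔ.1.isCompact.isBounded
    refine hΔ.mem_of_forall_dual fun n hn => ?_
    have h1 : toR m ⬝ᵥ n ≤ 0 := by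
      rw [hS₂] at hn
      refine dotProduct_le_of_mem_convexHull (fun v hv => ?_) hn
      by_cases hv0 : v = 0
      · simp [hv0, toR_zero]
      · refine hint m v (hmem₂ v hv _ hm) ?_
        rw [dotProduct_comm]
        exact hcon v (Finset.mem_erase.2 ⟨hv0, hv⟩)
    rw [smul_dotProduct, smul_eq_mul]
    nlinarith

theorem finite_lattice_points {Q : Set (Fin (d + 1) → ℝ)} (hQ : Bornology.IsBounded Q) :
    {m : Fin (d + 1) → ℤ | toR m ∈ Q}.Finite := by
  obtain ⟨C, hC0, hC⟩ := hQ.exists_pos_norm_le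
  refine (Set.finite_Icc (fun _ : Fin (d + 1) => -⌈C⌉) (fun _ => ⌈C⌉)).subset fun m hm => ?_
  have h1 : ∀ i, |(m i : ℝ)| ≤ ⌈C⌉ := fun i =>
    (norm_le_pi_norm (toR m) i).trans ((hC _ hm).trans (Int.le_ceil C))
  constructor <;> intro i <;> have := abs_le.1 (h1 i)
  · have := this.1; dsimp only; exact_mod_cast this
  · have := this.2; dsimp only; exact_mod_cast this

/-- The vector `0` only contributes `0 ≤ 0` and is dropped. If `h ≤ C` on generators of `Δ`, then
`dualH Δ h` lies in `C + 1` times the dual polytope, hence is bounded. -/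
theorem IsReflexive.exists_presents_dualH {Δ : Set (Fin (d + 1) → ℝ)} (hΔ : IsReflexive Δ)
    {h : (Fin (d + 1) → ℤ) → ℤ} (hh : IsHeight Δ h) :
    ∃ S, Presents (dualH Δ h) S (fun m => (h m : ℝ)) ∧ ∀ m, m ∈ S ↔ toR m ∈ Δ ∧ m ≠ 0 := by
  classical
  obtain ⟨T, -, hT⟩ := hΔ.exists_presents
  have hfin := finite_lattice_points hΔ.1.isCompact.isBounded
  have hS : ∀ m, m ∈ hfin.toFinset.erase 0 ↔ toR m ∈ Δ ∧ m ≠ 0 := fun m => by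
    rw [Finset.mem_erase, Set.Finite.mem_toFinset]
    exact and_comm
  refine ⟨hfin.toFinset.erase 0, ⟨fun x => ⟨fun hx m hm => hx m ((hS m).1 hm).1, fun hx m hm => ?_⟩,
    fun m hm => ?_, fun m hm => ?_, ?_⟩, hS⟩
  · by_cases hm0 : m = 0
    · simp [hm0, toR_zero, hh.1]
    · exact hx m ((hS m).2 ⟨hm, hm0⟩)
  · exact_mod_cast hh.2 m ((hS m).1 hm).1 ((hS m).1 hm).2
  · obtain ⟨v, -, hv⟩ := hT m ((hS m).1 hm).1 ((hS m).1 hm).2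
    exact ⟨v, hv⟩
  · obtain ⟨S₁, hS₁⟩ := hΔ.1
    obtain ⟨C, hC⟩ : ∃ C : ℕ, ∀ m ∈ S₁, h m ≤ C := by
      refine ⟨S₁.sup fun m => (h m).toNat, fun m hm => ?_⟩
      have := Finset.le_sup (f := fun m => (h m).toNat) hm
      have h2 := Int.self_le_toNat (h m)
      omega
    have hsub : dualH Δ h ⊆ (fun n => ((C : ℝ) + 1) • n) '' dualPolytope Δ := by
      intro n hn
      refine ⟨((C : ℝ) + 1)⁻¹ • n, fun x hx => ?_, ?_⟩
      · have h1 : n ⬝ᵥ x ≤ (C : ℝ) := by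
          rw [hS₁] at hx
          refine dotProduct_le_of_mem_convexHull (fun m hm => ?_) hx
          rw [dotProduct_comm]
          refine (hn m ?_).trans (by exact_mod_cast hC m hm)
          rw [hS₁]; exact subset_convexHull ℝ _ ⟨m, hm, rfl⟩
        rw [dotProduct_smul, dotProduct_comm, smul_eq_mul, inv_mul_le_iff₀ (by positivity)]
        linarith
      · change ((C : ℝ) + 1) • ((C : ℝ) + 1)⁻¹ • n = n
        rw [smul_smul, mul_inv_cancel₀ (by positivity), one_smul]
    exact (hΔ.2.isCompact.image (continuous_const_smul _)).isBounded.subset hsub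

/-! ### Unimodularity of the pairing between `v^⊥` and `u^⊥` -/

/-- A square integer matrix with a one-sided integer inverse has determinant `±1`. -/
theorem volume_image_of_integer_inverse {k l : ℕ} (hkl : k = l) (C : Fin k → Fin l → ℤ)
    (D : Fin l → Fin k → ℤ) (hDC : ∀ j j', ∑ i, D j i * C i j' = if j' = j then 1 else 0)
    (t : Fin l → ℝ) (Y : Set (Fin k → ℝ)) :
    volume ((fun y j => t j + ∑ i, y i * (C i j : ℝ)) '' Y) = volume Y := by
  subst hkl
  let M : Matrix (Fin k) (Fin k) ℤ := fun j i => C i j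
  let N : Matrix (Fin k) (Fin k) ℤ := fun i j => D j i
  have hM : M * N = 1 := by
    ext j' j
    rw [Matrix.mul_apply, Matrix.one_apply, ← hDC]
    exact Finset.sum_congr rfl fun i _ => mul_comm _ _
  have hdet : |((M.map (Int.cast : ℤ → ℝ)).det)| = 1 := by
    have h1 : IsUnit M.det := IsUnit.of_mul_eq_one _ (by rw [← Matrix.det_mul, hM, Matrix.det_one])
    have h2 : (M.map (Int.cast : ℤ → ℝ)).det = (M.det : ℝ) :=
      ((Int.castRingHom ℝ).map_det M).symm
    rw [h2]
    rcases Int.isUnit_iff.1 h1 with h | h <;> simp [h]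
  have hf : (fun (y : Fin k → ℝ) j => t j + ∑ i, y i * (C i j : ℝ)) =
      (fun z => t + z) ∘ Matrix.toLin' (M.map (Int.cast : ℤ → ℝ)) := by
    funext y j
    simp only [Function.comp, Pi.add_apply, Matrix.toLin'_apply, Matrix.mulVec, dotProduct, M]
    congr 1
    exact Finset.sum_congr rfl fun i _ => mul_comm _ _
  rw [hf, image_comp, image_add_left, measure_preimage_add, Measure.addHaar_image_linearMap,
    LinearMap.det_toLin', hdet]
  simp

/-- Coordinates dual to the basis of `u^⊥` on the quotient of `ℝ^(d+1)` by the line through `u`. -/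
def quotientCoord (u : Fin (d + 1) → ℤ) (p : Fin (d + 1) → ℝ) :
    Fin (Module.finrank ℤ (perp u)) → ℝ :=
  fun j => p ⬝ᵥ toR (Module.finBasis ℤ (perp u) j : Fin (d + 1) → ℤ)

/-- If `⟨v, u⟩ = 1`, the pairing between `v^⊥` and `u^⊥` is perfect: the functionals dual to the
basis of `u^⊥`, normalized to vanish on `v`, belong to `v^⊥`. Projection modulo `u` is therefore
unimodular on the hyperplane of `v`. -/
theorem volume_quotientCoord_param (Q : Set (Fin (d + 1) → ℝ)) {u v : Fin (d + 1) → ℤ}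
    (huv : v ⬝ᵥ u = 1) (Y : Set (Fin (Module.finrank ℤ (perp v)) → ℝ)) :
    volume ((fun y => quotientCoord u (param Q v y)) '' Y) = volume Y := by
  have huv' : u ⬝ᵥ v = 1 := by rw [dotProduct_comm, huv]
  obtain ⟨β, hβ0, hβ, -⟩ := exists_dual_basis huv'
  let c := Module.finBasis ℤ (perp v)
  let b := Module.finBasis ℤ (perp u)
  let β' : Fin (Module.finrank ℤ (perp u)) → perp v := fun j => ⟨β j, by
    change v ⬝ᵥ β j = 0
    rw [dotProduct_comm, hβ0]⟩
  have := volume_image_of_integer_inverse ((finrank_perp huv).trans (finrank_perp huv').symm)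
    (fun i j => (c i : Fin (d + 1) → ℤ) ⬝ᵥ (b j : Fin (d + 1) → ℤ))
    (fun j i => c.repr (β' j) i) (fun j j' => ?_)
    (fun j => basePoint Q v ⬝ᵥ toR (b j : Fin (d + 1) → ℤ)) Y
  · rw [← this]
    congr 2
    funext y j
    simp only [quotientCoord, param, add_dotProduct, sum_dotProduct, smul_dotProduct,
      toR_dotProduct_toR, smul_eq_mul, b, c]
  · rw [← hβ j j']
    have h1 := congrArg (Subtype.val : perp v → _) (c.sum_repr (β' j))
    rw [Submodule.coe_sum] at h1
    change _ = β j at h1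
    rw [← h1, sum_dotProduct]
    refine Finset.sum_congr rfl fun i _ => ?_
    rw [Submodule.coe_smul, smul_dotProduct, smul_eq_mul]

theorem quotientCoord_add_smul (u : Fin (d + 1) → ℤ) (p : Fin (d + 1) → ℝ) (t : ℝ) :
    quotientCoord u (p + t • toR u) = quotientCoord u p := by
  funext j
  have : u ⬝ᵥ (Module.finBasis ℤ (perp u) j : Fin (d + 1) → ℤ) = 0 :=
    (Module.finBasis ℤ (perp u) j).2
  simp [quotientCoord, add_dotProduct, smul_dotProduct, toR_dotProduct_toR, this]

/-! ### Subgradients of convex functions -/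

/-- Hahn–Banach: separate the open strict epigraph of `Ψ` from the graph of the supporting affine
function over the subspace. The separating functional has negative vertical part `α`, and dividing
by `-α` gives `p`. -/
theorem ConvexOn.exists_subgradient_extension {k N : ℕ} {Ψ : (Fin N → ℝ) → ℝ}
    (hΨ : ConvexOn ℝ univ Ψ) (B : (Fin k → ℝ) →ₗ[ℝ] (Fin N → ℝ)) (n : Fin N → ℝ)
    (x : Fin k → ℝ) (hx : ∀ z, Ψ n + x ⬝ᵥ z ≤ Ψ (n + B z)) :
    ∃ p : Fin N → ℝ, (∀ n', Ψ n + p ⬝ᵥ (n' - n) ≤ Ψ n') ∧ ∀ z, p ⬝ᵥ B z = x ⬝ᵥ z := by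
  have hcont : Continuous Ψ := by
    rw [← continuousOn_univ]; exact hΨ.continuousOn isOpen_univ
  have hopen : IsOpen {q : (Fin N → ℝ) × ℝ | Ψ q.1 < q.2} :=
    isOpen_lt (hcont.comp continuous_fst) continuous_snd
  have hconv : Convex ℝ {q : (Fin N → ℝ) × ℝ | Ψ q.1 < q.2} := by
    simpa using hΨ.convex_strict_epigraph
  have hconv' : Convex ℝ (range fun z => (n + B z, Ψ n + x ⬝ᵥ z)) := by
    rintro _ ⟨z, rfl⟩ _ ⟨z', rfl⟩ a b - - hab
    refine ⟨a • z + b • z', ?_⟩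
    ext1
    · simp only [map_add, map_smul, Prod.smul_mk, Prod.mk_add_mk, smul_add]
      nth_rewrite 1 [← one_smul ℝ n]
      rw [← hab, add_smul]; abel
    · simp only [dotProduct_add, dotProduct_smul, Prod.smul_mk, Prod.mk_add_mk, smul_eq_mul]
      linear_combination -(Ψ n) * hab
  obtain ⟨F, c, hF, hc⟩ := geometric_hahn_banach_open hconv hopen hconv' (by
    rw [Set.disjoint_left]
    rintro _ hq ⟨z, rfl⟩
    exact absurd (hx z) (not_le.2 hq))
  set F₁ : StrongDual ℝ (Fin N → ℝ) := F.comp (ContinuousLinearMap.inl ℝ _ _) with hF₁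
  set α := F (0, 1) with hα
  have hsplit : ∀ z r, F (z, r) = F₁ z + r * α := fun z r => by
    have : (z, r) = (z, (0 : ℝ)) + r • ((0 : Fin N → ℝ), (1 : ℝ)) := by simp
    rw [this, map_add, map_smul]; rfl
  have h0 : c ≤ F₁ n + Ψ n * α := by
    have := hc _ ⟨0, rfl⟩
    simpa [hsplit] using this
  have hα0 : α < 0 := by
    have := hF (n, Ψ n + 1) (by simp)
    rw [hsplit] at this
    linarith
  have hlim : ∀ z, F₁ z + Ψ z * α ≤ c := fun z => by
    by_contra hcon
    push Not at hcon
    have hpos : 0 < (F₁ z + Ψ z * α - c) / -α := div_pos (by linarith) (by linarith)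
    have h1 := hF (z, Ψ z + (F₁ z + Ψ z * α - c) / -α) (by simpa using hpos)
    have h2 : (F₁ z + Ψ z * α - c) / -α * α = -(F₁ z + Ψ z * α - c) := by
      have := hα0.ne
      field_simp
    rw [hsplit, add_mul, h2] at h1
    linarith
  obtain ⟨a, ha⟩ := exists_dotProduct_eq F₁
  -- Applied to `z` and to `-z`, this one-sided bound becomes the equality that fixes `p` on the
  -- image of `B`.
  have hB : ∀ z, 0 ≤ a ⬝ᵥ B z + (x ⬝ᵥ z) * α := fun z => by
    have h1 := hc _ ⟨z, rfl⟩
    simp only [hsplit, ha, dotProduct_add] at h1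
    have h2 := hlim n
    rw [ha] at h2
    linarith
  refine ⟨(-α)⁻¹ • a, fun n' => ?_, fun z => ?_⟩
  · have h1 := hlim n'
    rw [ha] at h1 h0
    rw [smul_dotProduct, smul_eq_mul, dotProduct_sub, ← le_sub_iff_add_le',
      inv_mul_le_iff₀ (by linarith)]
    linarith
  · have h1 := hB z
    have h2 := hB (-z)
    rw [map_neg, dotProduct_neg, dotProduct_neg] at h2
    have : a ⬝ᵥ B z = -α * (x ⬝ᵥ z) := by linarith
    rw [smul_dotProduct, smul_eq_mul, this, ← mul_assoc, inv_mul_cancel₀ (by linarith), one_mul]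

/-- Convexity along the segment from `y` to `y'` propagates the inequality from a nearby point of
`D`. -/
theorem subgradient_le_of_isOpen {k : ℕ} {f : (Fin k → ℝ) → ℝ} (hf : ConvexOn ℝ univ f)
    {D : Set (Fin k → ℝ)} (hD : IsOpen D) {x y : Fin k → ℝ} (hy : y ∈ D)
    (hx : x ∈ subgradient D f y) (y' : Fin k → ℝ) : f y + x ⬝ᵥ (y' - y) ≤ f y' := by
  have hc : Continuous fun t : ℝ => y + t • (y' - y) := by fun_prop
  have h1 : ∀ᶠ t in nhds (0 : ℝ), y + t • (y' - y) ∈ D :=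
    hc.continuousAt.eventually_mem (hD.mem_nhds (by simpa using hy))
  have h2 : ∀ᶠ t in nhds (0 : ℝ), t < 1 := gt_mem_nhds one_pos
  obtain ⟨t, ⟨ht, ht1⟩, ht0⟩ := (((h1.and h2).filter_mono nhdsWithin_le_nhds).and
    (self_mem_nhdsWithin (a := (0 : ℝ)) (s := Ioi 0))).exists
  have ht0' : 0 < t := ht0
  have h3 := hx _ ht
  rw [add_sub_cancel_left, dotProduct_smul, smul_eq_mul] at h3
  have h4 := hf.2 (mem_univ y) (mem_univ y') (by linarith : 0 ≤ 1 - t) ht0'.le (by ring)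
  have h5 : (1 - t) • y + t • y' = y + t • (y' - y) := by
    rw [sub_smul, smul_sub, one_smul]; abel
  rw [h5, smul_eq_mul, smul_eq_mul] at h4
  nlinarith

/-- The linear part of `param P u`. -/
def paramLin (u : Fin (d + 1) → ℤ) :
    (Fin (Module.finrank ℤ (perp u)) → ℝ) →ₗ[ℝ] (Fin (d + 1) → ℝ) :=
  Fintype.linearCombination ℝ fun j => toR (Module.finBasis ℤ (perp u) j : Fin (d + 1) → ℤ)

theorem param_eq (P : Set (Fin (d + 1) → ℝ)) (u : Fin (d + 1) → ℤ) (y) :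
    param P u y = basePoint P u + paramLin u y := by
  simp [param, paramLin, Fintype.linearCombination_apply]

theorem param_add (P : Set (Fin (d + 1) → ℝ)) (u : Fin (d + 1) → ℤ) (y z) :
    param P u (y + z) = param P u y + paramLin u z := by
  rw [param_eq, param_eq, map_add, add_assoc]

theorem convexOn_comp_param {Ψ : (Fin (d + 1) → ℝ) → ℝ} (hΨ : ConvexOn ℝ univ Ψ)
    (P : Set (Fin (d + 1) → ℝ)) (u : Fin (d + 1) → ℤ) : ConvexOn ℝ univ (Ψ ∘ param P u) := by
  refine ⟨convex_univ, fun y _ y' _ a b ha hb hab => ?_⟩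
  have h := hΨ.2 (mem_univ (param P u y)) (mem_univ (param P u y')) ha hb hab
  have h2 : param P u (a • y + b • y') = a • param P u y + b • param P u y' := by
    simp only [param_eq, map_add, map_smul, smul_add]
    nth_rewrite 1 [← one_smul ℝ (basePoint P u)]
    rw [← hab, add_smul]; abel
  simp only [Function.comp, h2]
  exact h

theorem exists_global_subgradient {Ψ : (Fin (d + 1) → ℝ) → ℝ} (hΨ : ConvexOn ℝ univ Ψ)
    (P : Set (Fin (d + 1) → ℝ)) (u : Fin (d + 1) → ℤ) {D} (hD : IsOpen D) {x y} (hy : y ∈ D)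
    (hx : x ∈ subgradient D (Ψ ∘ param P u) y) :
    ∃ p, (∀ n', Ψ (param P u y) + p ⬝ᵥ (n' - param P u y) ≤ Ψ n') ∧ quotientCoord u p = x := by
  classical
  obtain ⟨p, hp, hpx⟩ := ConvexOn.exists_subgradient_extension hΨ (paramLin u) (param P u y) x
    fun z => by
      have := subgradient_le_of_isOpen (convexOn_comp_param hΨ P u) hD hy hx (y + z)
      rwa [add_sub_cancel_left, Function.comp, Function.comp, param_add] at this
  refine ⟨p, hp, funext fun j => ?_⟩
  have := hpx (Pi.single j 1)
  rw [paramLin, Fintype.linearCombination_apply_single] at this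
  simpa [quotientCoord] using this

/-- For `w` in the dual polytope `Ψ(t • w) ≤ t + C`, so the slope `⟨p, w⟩` is at most 1, and the
bipolar theorem applies. -/
theorem MemP.mem_of_subgradient {Δ : Set (Fin (d + 1) → ℝ)} (hΔ : IsReflexive Δ)
    {Ψ : (Fin (d + 1) → ℝ) → ℝ} (hΨ : MemP Δ Ψ) {n p : Fin (d + 1) → ℝ}
    (hp : ∀ n', Ψ n + p ⬝ᵥ (n' - n) ≤ Ψ n') : p ∈ Δ := by
  refine hΔ.mem_of_forall_dual fun w hw => ?_
  obtain ⟨C, hC⟩ := hΨ.2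
  have key : ∀ t : ℝ, 0 < t → t * (p ⬝ᵥ w) ≤ t + (C - Ψ n + p ⬝ᵥ n) := by
    intro t ht
    have h1 := hp (t • w)
    have h2 := (abs_le.1 (hC (t • w))).2
    have h3 : sSup ((fun m => toR m ⬝ᵥ (t • w)) '' {m | toR m ∈ Δ}) ≤ t := by
      refine Real.sSup_le ?_ ht.le
      rintro _ ⟨m, hm, rfl⟩
      have := hw _ hm
      simp only [dotProduct_smul, smul_eq_mul]
      nlinarith
    rw [dotProduct_sub, dotProduct_smul, smul_eq_mul] at h1
    linarith
  by_contra hcon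
  push Not at hcon
  set K := C - Ψ n + p ⬝ᵥ n
  -- This `t` makes `t * (⟨p, w⟩ - 1)` equal to `|K| + 1`, which exceeds `K`.
  have h1 := key ((|K| + 1) / (p ⬝ᵥ w - 1)) (div_pos (by positivity) (by linarith))
  have h2 : (|K| + 1) / (p ⬝ᵥ w - 1) * (p ⬝ᵥ w - 1) = |K| + 1 :=
    div_mul_cancel₀ _ (by linarith)
  have := le_abs_self K
  nlinarith

theorem MemP.continuous {Δ : Set (Fin (d + 1) → ℝ)} {Ψ : (Fin (d + 1) → ℝ) → ℝ}
    (hΨ : MemP Δ Ψ) : Continuous Ψ := by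
  rw [← continuousOn_univ]; exact hΨ.1.continuousOn isOpen_univ

/-- Moving a point of `Δ` in the direction `u` until it leaves `Δ`. -/
theorem Presents.exists_push {Δ : Set (Fin (d + 1) → ℝ)} {S : Finset (Fin (d + 1) → ℤ)}
    (hS : Presents Δ S fun _ => 1) {u : Fin (d + 1) → ℤ} (hu : toR u ∈ Δ)
    (huv : ∃ v ∈ S, v ⬝ᵥ u = 1) {p : Fin (d + 1) → ℝ} (hp : p ∈ Δ) :
    ∃ t : ℝ, 0 ≤ t ∧ p + t • toR u ∈ Δ ∧ ∃ v ∈ S, v ⬝ᵥ u = 1 ∧ toR v ⬝ᵥ (p + t • toR u) = 1 := by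
  classical
  obtain ⟨v₀, hv₀, hv₀u⟩ := huv
  -- Only constraints with `⟨v, u⟩ = 1` get tighter, as the others have `⟨v, u⟩ ≤ 0` by integrality.
  -- The slack of such a constraint is the time at which it becomes tight, so the least slack is the
  -- exit time.
  obtain ⟨v, hv, hmin⟩ := (S.filter fun v => v ⬝ᵥ u = 1).exists_min_image
    (fun v => 1 - toR v ⬝ᵥ p) ⟨v₀, Finset.mem_filter.2 ⟨hv₀, hv₀u⟩⟩
  obtain ⟨hvS, hvu⟩ := Finset.mem_filter.1 hv
  have hvp := (hS.mem_iff p).1 hp v hvS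
  refine ⟨1 - toR v ⬝ᵥ p, by linarith, (hS.mem_iff _).2 fun m hm => ?_, v, hvS, hvu, ?_⟩
  · rw [dotProduct_add, dotProduct_smul, toR_dotProduct_toR, smul_eq_mul]
    by_cases h1 : m ⬝ᵥ u = 1
    · have := hmin m (Finset.mem_filter.2 ⟨hm, h1⟩)
      rw [h1]; push_cast; linarith
    · have h2 := (hS.mem_iff _).1 hu m hm
      rw [toR_dotProduct_toR] at h2
      have h3 : m ⬝ᵥ u ≤ 1 := by exact_mod_cast h2
      have h4 : ((m ⬝ᵥ u : ℤ) : ℝ) ≤ 0 := by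
        have : m ⬝ᵥ u ≤ 0 := by omega
        exact_mod_cast this
      have h5 := (hS.mem_iff p).1 hp m hm
      nlinarith
  · rw [dotProduct_add, dotProduct_smul, toR_dotProduct_toR, smul_eq_mul, hvu]; push_cast; ring

/-- These points lie in a proper affine subspace of the hyperplane of `v`, on which projection
modulo `u` preserves volume. -/
theorem Presents.volume_doubly_tight {Q : Set (Fin (d + 1) → ℝ)} {S : Finset (Fin (d + 1) → ℤ)}
    {h : (Fin (d + 1) → ℤ) → ℝ} (hQ : Presents Q S h) {u v v' : Fin (d + 1) → ℤ} (hv : v ∈ S)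
    (hv' : v' ∈ S) (hne : v ≠ v') (hvu : v ⬝ᵥ u = 1) :
    volume (quotientCoord u '' {p ∈ Q | toR v ⬝ᵥ p = h v ∧ toR v' ⬝ᵥ p = h v'}) = 0 := by
  rcases eq_empty_or_nonempty {p ∈ Q | toR v ⬝ᵥ p = h v ∧ toR v' ⬝ᵥ p = h v'} with he | ⟨p₀, hp₀⟩
  · rw [he]; simp
  obtain ⟨g, -, -, hg⟩ := exists_leftInverse_param (P := Q) hvu
  have hbase : toR v ⬝ᵥ basePoint Q v = h v := by
    rw [dotProduct_basePoint (hQ.ne_zero hv), hQ.sSup_eq_of_tight hv hp₀.1 hp₀.2.1]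
  set a : Fin (Module.finrank ℤ (perp v)) → ℝ :=
    fun j => toR v' ⬝ᵥ toR (Module.finBasis ℤ (perp v) j : Fin (d + 1) → ℤ) with ha
  have hlin : ∀ y, toR v' ⬝ᵥ paramLin v y = a ⬝ᵥ y := fun y => by
    rw [paramLin, Fintype.linearCombination_apply, dotProduct_sum, dotProduct]
    exact Finset.sum_congr rfl fun j _ => by rw [dotProduct_smul, smul_eq_mul, mul_comm]
  have ha0 : a ≠ 0 := by
    intro h0
    obtain ⟨c, hc⟩ := exists_smul_eq_of_ker_le (a := toR v) (b := toR v') fun x hx => by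
      have h1 := hg (basePoint Q v + x) (by rw [dotProduct_add, hx, add_zero])
      rw [param_eq, add_right_inj] at h1
      rw [← h1, hlin, h0, zero_dotProduct]
    obtain ⟨w, hw⟩ := hQ.unimodular v hv
    obtain ⟨w', hw'⟩ := hQ.unimodular v' hv'
    have h2 := hp₀.2.2
    rw [hc, smul_dotProduct, hp₀.2.1, smul_eq_mul] at h2
    have h3 : 0 < c := by
      have := hQ.pos v' hv'
      rw [← h2] at this
      exact pos_of_mul_pos_left this (hQ.pos v hv).le
    exact hne (eq_of_smul_eq hw hw' h3 hc).symm
  refine measure_mono_null ?_ ((volume_quotientCoord_param Q hvu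
    {y | a ⬝ᵥ y = h v' - toR v' ⬝ᵥ basePoint Q v}).trans (volume_hyperplane_eq_zero ha0 _))
  rintro _ ⟨p, ⟨-, hp, hp'⟩, rfl⟩
  have h1 := hg p (hp.trans hbase.symm)
  refine ⟨g p, ?_, by dsimp only; rw [h1]⟩
  change a ⬝ᵥ g p = _
  rw [← h1, param_eq, dotProduct_add, hlin] at hp'
  linarith

/-- An open set is a countable union of closed sets and `X` is σ-compact, so the image is a
countable union of compact sets. -/
theorem measurableSet_image_inter {X Y : Type*} [MetricSpace X] [ProperSpace X]
    [TopologicalSpace Y] [T2Space Y] [MeasurableSpace Y] [BorelSpace Y] {f : X → Y}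
    (hf : Continuous f) {Z W : Set X} (hZ : IsClosed Z) (hW : IsOpen W) :
    MeasurableSet (f '' (Z ∩ W)) := by
  obtain ⟨F, hF, -, hFW, -⟩ := hW.exists_iUnion_isClosed
  have : f '' (Z ∩ W) = ⋃ n : ℕ, ⋃ k : ℕ, f '' ((Z ∩ F n) ∩ compactCovering X k) := by
    rw [← hFW, inter_iUnion, image_iUnion]
    congr 1; funext n
    rw [← image_iUnion, ← inter_iUnion, iUnion_compactCovering, inter_univ]
  rw [this]
  exact MeasurableSet.iUnion fun n => MeasurableSet.iUnion fun k =>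
    (((isCompact_compactCovering X k).inter_left (hZ.inter (hF n))).image hf).isClosed.measurableSet

/-- A solution of the Monge–Ampère equation, together with presentations of both polytopes. -/
structure Setting (Δ : Set (Fin (d + 1) → ℝ)) (h : (Fin (d + 1) → ℤ) → ℤ)
    (Ψ : (Fin (d + 1) → ℝ) → ℝ) (S T : Finset (Fin (d + 1) → ℤ)) : Prop where
  one_le : 1 ≤ d
  reflexive : IsReflexive Δ
  presents : Presents Δ S fun _ => 1
  exists_pair : ∀ m, toR m ∈ Δ → m ≠ 0 → ∃ v ∈ S, v ⬝ᵥ m = 1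
  presentsH : Presents (dualH Δ h) T fun m => (h m : ℝ)
  mem_iff : ∀ m, m ∈ T ↔ toR m ∈ Δ ∧ m ≠ 0
  solution : IsSolution Δ h Ψ

/-- `p` is a `c`-subgradient of `Ψ|_B` at `n`: the supremum defining `Ψ^c(p)` is attained at `n`. -/
def Contact (Δ : Set (Fin (d + 1) → ℝ)) (h : (Fin (d + 1) → ℤ) → ℤ)
    (Ψ : (Fin (d + 1) → ℝ) → ℝ) (p n : Fin (d + 1) → ℝ) : Prop :=
  n ∈ frontier (dualH Δ h) ∧ cTransform Δ h Ψ p ≤ p ⬝ᵥ n - Ψ n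

/-- The points in the open facets of `Δ` containing `u` which are in contact with `X`. -/
def transport (Δ : Set (Fin (d + 1) → ℝ)) (h : (Fin (d + 1) → ℤ) → ℤ)
    (Ψ : (Fin (d + 1) → ℝ) → ℝ) (u : Fin (d + 1) → ℤ) (X : Set (Fin (d + 1) → ℝ)) :
    Set (Fin (d + 1) → ℝ) :=
  {p | ∃ v, IsFacetNormal Δ v ∧ v ⬝ᵥ u = 1 ∧ p ∈ faceInterior Δ v ∧ ∃ n ∈ X, Contact Δ h Ψ p n}

/-! ### Contact points and the mass inequality for transport -/

namespace Setting

variable {Δ : Set (Fin (d + 1) → ℝ)} {h : (Fin (d + 1) → ℤ) → ℤ} {Ψ : (Fin (d + 1) → ℝ) → ℝ}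
  {S T : Finset (Fin (d + 1) → ℤ)}

theorem continuous (hs : Setting Δ h Ψ S T) : Continuous Ψ := hs.solution.1.continuous

theorem mem_of_facet (hs : Setting Δ h Ψ S T) {u : Fin (d + 1) → ℤ}
    (hu : IsFacetNormal (dualH Δ h) u) : toR u ∈ Δ :=
  ((hs.mem_iff u).1 (hs.presentsH.mem_of_isFacetNormal hs.one_le hu)).1

theorem bddAbove (hs : Setting Δ h Ψ S T) (p : Fin (d + 1) → ℝ) :
    BddAbove ((fun n => p ⬝ᵥ n - Ψ n) '' frontier (dualH Δ h)) :=
  (hs.presentsH.isCompact_frontier.image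
    ((continuous_dotProduct_left p).sub hs.continuous)).bddAbove

theorem le_cTransform (hs : Setting Δ h Ψ S T) (p : Fin (d + 1) → ℝ) {n : Fin (d + 1) → ℝ}
    (hn : n ∈ frontier (dualH Δ h)) : p ⬝ᵥ n - Ψ n ≤ cTransform Δ h Ψ p :=
  le_csSup (hs.bddAbove p) ⟨n, hn, rfl⟩

theorem frontierH_nonempty (hs : Setting Δ h Ψ S T) : (frontier (dualH Δ h)).Nonempty := by
  obtain ⟨u, hu, ⟨x, hx⟩, -⟩ := hs.presentsH.exists_facet_nonneg hs.one_le 0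
  exact ⟨x, hs.presentsH.faceInterior_subset_frontier hs.one_le hu hx⟩

/-- A supremum of affine functions with slopes in the bounded set `B`. Lipschitz continuity gives
access to Rademacher's theorem. -/
theorem exists_lipschitz (hs : Setting Δ h Ψ S T) :
    ∃ K, LipschitzWith K (cTransform Δ h Ψ) := by
  obtain ⟨C, hC0, hC⟩ := hs.presentsH.bounded.exists_pos_norm_le
  have hdot : ∀ p n : Fin (d + 1) → ℝ, p ⬝ᵥ n ≤ (d + 1) * (‖p‖ * ‖n‖) := by
    intro p n
    have : ∀ i ∈ Finset.univ, p i * n i ≤ ‖p‖ * ‖n‖ := fun i _ =>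
      (le_abs_self _).trans (by
        rw [abs_mul]
        exact mul_le_mul (norm_le_pi_norm p i) (norm_le_pi_norm n i) (abs_nonneg _) (norm_nonneg _))
    have := Finset.sum_le_card_nsmul _ _ _ this
    simpa [dotProduct] using this
  refine ⟨NNReal.mk ((d + 1) * C) (by positivity), LipschitzWith.of_le_add_mul _ fun p q => ?_⟩
  refine csSup_le (hs.frontierH_nonempty.image _) ?_
  rintro _ ⟨n, hn, rfl⟩
  have h1 := hs.le_cTransform q hn
  have h2 := hdot (p - q) n
  have h3 := hC n (hs.presentsH.frontier_subset hn)
  rw [sub_dotProduct] at h2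
  have h4 : (d + 1) * (‖p - q‖ * ‖n‖) ≤ (d + 1) * (‖p - q‖ * C) := by gcongr
  rw [NNReal.coe_mk, dist_eq_norm]
  dsimp only
  linarith

theorem continuous_cTransform (hs : Setting Δ h Ψ S T) : Continuous (cTransform Δ h Ψ) := by
  obtain ⟨K, hK⟩ := hs.exists_lipschitz
  exact hK.continuous

theorem isClosed_contact (hs : Setting Δ h Ψ S T) :
    IsClosed {q : (Fin (d + 1) → ℝ) × (Fin (d + 1) → ℝ) | Contact Δ h Ψ q.1 q.2} := by
  have hdot : Continuous fun q : (Fin (d + 1) → ℝ) × (Fin (d + 1) → ℝ) => q.1 ⬝ᵥ q.2 := by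
    unfold dotProduct; fun_prop
  exact (isClosed_frontier.preimage continuous_snd).inter
    (isClosed_le (hs.continuous_cTransform.comp continuous_fst)
      (hdot.sub (hs.continuous.comp continuous_snd)))

theorem mem_cGradient_of_contact (hs : Setting Δ h Ψ S T) {p n : Fin (d + 1) → ℝ}
    (hc : Contact Δ h Ψ p n) : n ∈ cGradient Δ h (cTransform Δ h Ψ) p := by
  refine ⟨hc.1, fun q _ => ?_⟩
  have := hs.le_cTransform q hc.1
  rw [sub_dotProduct]
  linarith [hc.2]

/-- A subgradient of `Ψ` at a point `n` of the facet with normal `u` has the same image modulo `u`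
as a point of the star of `u` which is in contact with `n`. -/
theorem exists_contact (hs : Setting Δ h Ψ S T) {u : Fin (d + 1) → ℤ} (hu : u ∈ T)
    {n p : Fin (d + 1) → ℝ} (hn : n ∈ dualH Δ h) (hnu : toR u ⬝ᵥ n = h u)
    (hp : ∀ n', Ψ n + p ⬝ᵥ (n' - n) ≤ Ψ n') :
    ∃ p' ∈ Δ, quotientCoord u p' = quotientCoord u p ∧ Contact Δ h Ψ p' n ∧
      ∃ v ∈ S, v ⬝ᵥ u = 1 ∧ toR v ⬝ᵥ p' = 1 := by
  obtain ⟨huΔ, hu0⟩ := (hs.mem_iff u).1 hu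
  obtain ⟨t, ht, hp', v, hv, hvu, hvp⟩ := hs.presents.exists_push huΔ (hs.exists_pair u huΔ hu0)
    (hs.solution.1.mem_of_subgradient hs.reflexive hp)
  refine ⟨p + t • toR u, hp', quotientCoord_add_smul u p t,
    ⟨hs.presentsH.mem_frontier_iff.2 ⟨hn, u, hu, hnu⟩, ?_⟩, v, hv, hvu, hvp⟩
  -- Replacing `p` by `p + t • toR u` adds `t⟨u, n'⟩ ≤ t h(u)` at `n'`, with equality at `n`; so `n`
  -- still attains the supremum over `B`.
  refine csSup_le (hs.frontierH_nonempty.image _) ?_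
  rintro _ ⟨n', hn', rfl⟩
  have h1 := hp n'
  have h2 := (hs.presentsH.mem_iff n').1 (hs.presentsH.frontier_subset hn') u hu
  simp only [add_dotProduct, smul_dotProduct, smul_eq_mul, dotProduct_sub] at h1 ⊢
  nlinarith

/-- A subgradient on the facet lifts to a point of `Δ`, which is pushed along `u`. The end point is
either inside one facet, giving the transport, or on two facets, giving the second, negligible
union. -/
theorem subgradient_image_subset (hs : Setting Δ h Ψ S T) {u : Fin (d + 1) → ℤ}
    (hu : IsFacetNormal (dualH Δ h) u) {X : Set (Fin (d + 1) → ℝ)}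
    (hXu : X ⊆ faceInterior (dualH Δ h) u) :
    (⋃ y ∈ param (dualH Δ h) u ⁻¹' X,
      subgradient (param (dualH Δ h) u ⁻¹' faceInterior (dualH Δ h) u)
        (Ψ ∘ param (dualH Δ h) u) y) ⊆
      (⋃ v : {v : Fin (d + 1) → ℤ // IsFacetNormal Δ v ∧ v ⬝ᵥ u = 1},
        quotientCoord u '' (transport Δ h Ψ u X ∩ faceInterior Δ v.1)) ∪
      ⋃ q ∈ {q : (Fin (d + 1) → ℤ) × (Fin (d + 1) → ℤ) |
          (q.1 ∈ S ∧ q.2 ∈ S) ∧ q.1 ≠ q.2 ∧ q.1 ⬝ᵥ u = 1},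
        quotientCoord u '' {p ∈ Δ | toR q.1 ⬝ᵥ p = 1 ∧ toR q.2 ⬝ᵥ p = 1} := by
  have hd := hs.one_le
  have huT := hs.presentsH.mem_of_isFacetNormal hd hu
  intro x hx
  obtain ⟨y, hy, hx⟩ := mem_iUnion₂.1 hx
  have hyF : param (dualH Δ h) u y ∈ Presents.tightOnly T (fun m => (h m : ℝ)) u := by
    rw [← hs.presentsH.faceInterior_eq hd hu]; exact hXu hy
  have hopen : IsOpen (param (dualH Δ h) u ⁻¹' faceInterior (dualH Δ h) u) := by
    rw [hs.presentsH.faceInterior_eq hd hu]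
    convert (Presents.isOpen_others T (fun m => (h m : ℝ)) u).preimage
      (continuous_param (P := dualH Δ h) (u := u)) using 1
    ext z
    exact ⟨fun hz => hz.2, fun hz => ⟨hs.presentsH.dotProduct_param hd hu z, hz⟩⟩
  obtain ⟨p, hp, rfl⟩ := exists_global_subgradient hs.solution.1.1 _ u hopen (hXu hy) hx
  obtain ⟨p', hp', hq, hc, v, hv, hvu, hvp⟩ := hs.exists_contact huT
    (hs.presentsH.tightOnly_subset hyF) hyF.1 hp
  by_cases htight : ∃ v' ∈ S, v' ≠ v ∧ toR v' ⬝ᵥ p' = 1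
  · obtain ⟨v', hv', hne, hvp'⟩ := htight
    exact Or.inr (mem_iUnion₂.2 ⟨(v, v'), ⟨⟨hv, hv'⟩, hne.symm, hvu⟩, p', ⟨hp', hvp, hvp'⟩, hq⟩)
  · push Not at htight
    have hpt : p' ∈ Presents.tightOnly S (fun _ => 1) v :=
      ⟨hvp, fun m hm hne => lt_of_le_of_ne ((hs.presents.mem_iff _).1 hp' m hm)
        (htight m hm hne)⟩
    have hvf := hs.presents.isFacetNormal_of_mem_tightOnly hv hpt
    rw [← hs.presents.faceInterior_eq hd hvf] at hpt
    exact Or.inl (mem_iUnion.2 ⟨⟨v, hvf, hvu⟩, p', ⟨⟨v, hvf, hvu, hpt, _, hy, hc⟩, hpt⟩, hq⟩)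

theorem nuN_le_muM_transport (hs : Setting Δ h Ψ S T) {u : Fin (d + 1) → ℤ}
    (hu : IsFacetNormal (dualH Δ h) u) {X : Set (Fin (d + 1) → ℝ)} (hX : MeasurableSet X)
    (hXu : X ⊆ faceInterior (dualH Δ h) u) : nuN Δ h X ≤ muM Δ (transport Δ h Ψ u X) := by
  have hd := hs.one_le
  have hN : volume (⋃ q ∈ {q : (Fin (d + 1) → ℤ) × (Fin (d + 1) → ℤ) |
      (q.1 ∈ S ∧ q.2 ∈ S) ∧ q.1 ≠ q.2 ∧ q.1 ⬝ᵥ u = 1},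
      quotientCoord u '' {p ∈ Δ | toR q.1 ⬝ᵥ p = 1 ∧ toR q.2 ⬝ᵥ p = 1}) = 0 := by
    refine (measure_biUnion_null_iff (to_countable _)).2 fun q hq => ?_
    obtain ⟨⟨h1, h2⟩, h3, h4⟩ := hq
    exact hs.presents.volume_doubly_tight h1 h2 h3 h4
  have hA : ∀ v : {v : Fin (d + 1) → ℤ // IsFacetNormal Δ v ∧ v ⬝ᵥ u = 1},
      volume (quotientCoord u '' (transport Δ h Ψ u X ∩ faceInterior Δ v.1)) ≤
      volume (param Δ v.1 ⁻¹' (transport Δ h Ψ u X ∩ faceInterior Δ v.1)) := by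
    intro v
    rw [← volume_quotientCoord_param Δ v.2.2]
    refine measure_mono ?_
    rintro _ ⟨p, hp, rfl⟩
    have hp2 := hp.2
    rw [hs.presents.faceInterior_eq hd v.2.1] at hp2
    obtain ⟨y, rfl⟩ := hs.presents.exists_param_eq hd v.2.1 hp2.1
    exact ⟨y, hp, rfl⟩
  have hsum : ∑' v : {v : Fin (d + 1) → ℤ // IsFacetNormal Δ v ∧ v ⬝ᵥ u = 1},
      volume (param Δ v.1 ⁻¹' (transport Δ h Ψ u X ∩ faceInterior Δ v.1)) ≤
      muM Δ (transport Δ h Ψ u X) := by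
    rw [muM, hs.presents.integralMeasure_apply hd]
    exact ENNReal.tsum_comp_le_tsum_of_injective
      (f := fun v : {v : Fin (d + 1) → ℤ // IsFacetNormal Δ v ∧ v ⬝ᵥ u = 1} =>
        (⟨v.1, v.2.1⟩ : {v : Fin (d + 1) → ℤ // IsFacetNormal Δ v}))
      (fun a b hab => Subtype.ext (Subtype.mk.inj hab))
      (fun v => volume (param Δ v.1 ⁻¹' (transport Δ h Ψ u X ∩ faceInterior Δ v.1)))
  rw [← hs.solution.2 u hu X hX hXu, mongeAmpere]
  refine (measure_mono (hs.subgradient_image_subset hu hXu)).trans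
    ((measure_union_le _ _).trans ?_)
  rw [hN, add_zero]
  exact (measure_iUnion_le _).trans ((ENNReal.tsum_le_tsum hA).trans hsum)

/-- Where `Ψ^c` is differentiable along the facet `v`, its derivative determines the contact point
up to a multiple `c` of `v`. Both `u₁` and `u₂` pair to 1 with `v`, which forces `c = 0`. -/
theorem muM_transport_inter (hs : Setting Δ h Ψ S T) {u₁ u₂ : Fin (d + 1) → ℤ}
    (hu₁ : IsFacetNormal (dualH Δ h) u₁) (hu₂ : IsFacetNormal (dualH Δ h) u₂)
    {X₁ X₂ : Set (Fin (d + 1) → ℝ)} (hX₁ : X₁ ⊆ faceInterior (dualH Δ h) u₁)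
    (hX₂ : X₂ ⊆ faceInterior (dualH Δ h) u₂) (hX : Disjoint X₁ X₂) :
    muM Δ (transport Δ h Ψ u₁ X₁ ∩ transport Δ h Ψ u₂ X₂) = 0 := by
  have hd := hs.one_le
  rw [muM, hs.presents.integralMeasure_apply hd, ENNReal.tsum_eq_zero]
  rintro ⟨v, hv⟩
  obtain ⟨K, hK⟩ := hs.exists_lipschitz
  have hlip : ∃ K', LipschitzWith K' (cTransform Δ h Ψ ∘ param Δ v) := by
    refine ⟨K * ‖(paramLin v).toContinuousLinearMap‖₊,
      hK.comp (LipschitzWith.of_dist_le_mul fun y z => ?_)⟩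
    rw [param_eq, param_eq, dist_add_left, dist_eq_norm, dist_eq_norm, ← map_sub]
    exact (paramLin v).toContinuousLinearMap.le_opNorm _
  obtain ⟨K', hK'⟩ := hlip
  refine measure_mono_null (fun y hy => ?_) (hK'.ae_differentiableAt (μ := volume))
  intro hdiff
  obtain ⟨⟨⟨v₁, hv₁, hvu₁, hp₁, n₁, hn₁, hc₁⟩, ⟨v₂, hv₂, hvu₂, hp₂, n₂, hn₂, hc₂⟩⟩, hp⟩ := hy
  have hv₁e : v₁ = v := by
    by_contra hne
    exact Set.disjoint_left.1 (hs.presents.faceInterior_disjoint hd hv₁ hv hne) hp₁ hp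
  have hv₂e : v₂ = v := by
    by_contra hne
    exact Set.disjoint_left.1 (hs.presents.faceInterior_disjoint hd hv₂ hv hne) hp₂ hp
  subst hv₁e; subst hv₂e
  -- the derivative is determined by the contact points
  have hder : ∀ n, Contact Δ h Ψ (param Δ v₂ y) n → ∀ z,
      fderiv ℝ (cTransform Δ h Ψ ∘ param Δ v₂) y z = paramLin v₂ z ⬝ᵥ n := by
    intro n hc z
    let ℓ : (Fin (Module.finrank ℤ (perp v₂)) → ℝ) →L[ℝ] ℝ :=
      ((dotLin n) ∘ₗ paramLin v₂).toContinuousLinearMap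
    have h3 : ∀ z, ℓ z = paramLin v₂ z ⬝ᵥ n := fun z => by
      rw [dotProduct_comm]; rfl
    -- Contact says that `Ψ^c` minus the functional `n` is minimal at this point, so the two
    -- derivatives agree.
    have hmin : IsLocalMin (fun y' => (cTransform Δ h Ψ ∘ param Δ v₂) y' - ℓ y') y := by
      refine Filter.Eventually.of_forall fun y' => ?_
      have h1 := hs.le_cTransform (param Δ v₂ y') hc.1
      have h2 := hc.2
      simp only [Function.comp, h3]
      rw [param_eq, add_dotProduct] at h1 h2
      rw [param_eq, param_eq]
      linarith
    have := hmin.hasFDerivAt_eq_zero (hdiff.hasFDerivAt.sub ℓ.hasFDerivAt)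
    rw [sub_eq_zero] at this
    rw [this, h3]
  have hort : ∀ x, toR v₂ ⬝ᵥ x = 0 → (n₁ - n₂) ⬝ᵥ x = 0 := by
    intro x hx
    obtain ⟨g, -, -, hg⟩ := exists_leftInverse_param (P := Δ) hvu₂
    have h1 := hg (basePoint Δ v₂ + x) (by rw [dotProduct_add, hx, add_zero])
    rw [param_eq, add_right_inj] at h1
    have h2 := (hder n₁ hc₁ (g (basePoint Δ v₂ + x))).symm.trans (hder n₂ hc₂ _)
    rw [h1] at h2
    rw [sub_dotProduct, dotProduct_comm, h2, dotProduct_comm, sub_self]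
  obtain ⟨c, hc⟩ := exists_smul_eq_of_ker_le hort
  have hpair : ∀ u, v₂ ⬝ᵥ u = 1 → toR u ⬝ᵥ (n₁ - n₂) = c := by
    intro u hvu
    rw [hc, dotProduct_smul, toR_dotProduct_toR, dotProduct_comm, hvu]; simp
  have hF₁ := hX₁ hn₁
  have hF₂ := hX₂ hn₂
  rw [hs.presentsH.faceInterior_eq hd hu₁] at hF₁
  rw [hs.presentsH.faceInterior_eq hd hu₂] at hF₂
  have h1 := hpair u₁ hvu₁
  have h2 := hpair u₂ hvu₂
  have h3 := (hs.presentsH.mem_iff _).1 (hs.presentsH.tightOnly_subset hF₂) u₁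
    (hs.presentsH.mem_of_isFacetNormal hd hu₁)
  have h4 := (hs.presentsH.mem_iff _).1 (hs.presentsH.tightOnly_subset hF₁) u₂
    (hs.presentsH.mem_of_isFacetNormal hd hu₂)
  rw [dotProduct_sub, hF₁.1] at h1
  rw [dotProduct_sub, hF₂.1] at h2
  -- `⟨u₁, n₁ - n₂⟩ ≥ 0` since `n₁` is maximal for `u₁`, and `⟨u₂, n₁ - n₂⟩ ≤ 0` since `n₂` is
  -- maximal for `u₂`; both pairings equal `c`.
  have hc0 : c = 0 := by linarith
  rw [hc0, zero_smul, sub_eq_zero] at hc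
  exact Set.disjoint_left.1 hX hn₁ (hc ▸ hn₂)

/-- For each `v` the set is the projection of a closed set intersected with an open one: contact and
the two tight equations are closed, the strict inequalities and `O` are open. -/
theorem measurableSet_transport (hs : Setting Δ h Ψ S T) {u : Fin (d + 1) → ℤ}
    (hu : IsFacetNormal (dualH Δ h) u) {O : Set (Fin (d + 1) → ℝ)} (hO : IsOpen O) :
    MeasurableSet (transport Δ h Ψ u (faceInterior (dualH Δ h) u ∩ O)) := by
  have hd := hs.one_le
  have : transport Δ h Ψ u (faceInterior (dualH Δ h) u ∩ O) =
      ⋃ v ∈ {v | IsFacetNormal Δ v ∧ v ⬝ᵥ u = 1}, Prod.fst ''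
        (({q : (Fin (d + 1) → ℝ) × (Fin (d + 1) → ℝ) | Contact Δ h Ψ q.1 q.2} ∩
          ({p | toR v ⬝ᵥ p = 1} ×ˢ {n | toR u ⬝ᵥ n = h u})) ∩
          ({p | ∀ m ∈ S, m ≠ v → toR m ⬝ᵥ p < 1} ×ˢ
            ({n | ∀ m ∈ T, m ≠ u → toR m ⬝ᵥ n < h m} ∩ O))) := by
    ext p
    simp only [mem_iUnion, exists_prop]
    constructor
    · rintro ⟨v, hv, hvu, hp, n, ⟨hn, hnO⟩, hc⟩
      rw [hs.presents.faceInterior_eq hd hv] at hp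
      rw [hs.presentsH.faceInterior_eq hd hu] at hn
      exact ⟨v, ⟨hv, hvu⟩, (p, n), ⟨⟨hc, hp.1, hn.1⟩, hp.2, hn.2, hnO⟩, rfl⟩
    · rintro ⟨v, ⟨hv, hvu⟩, ⟨p, n⟩, ⟨⟨hc, hp1, hn1⟩, hp2, hn2, hnO⟩, rfl⟩
      refine ⟨v, hv, hvu, ?_, n, ⟨?_, hnO⟩, hc⟩
      · rw [hs.presents.faceInterior_eq hd hv]; exact ⟨hp1, hp2⟩
      · rw [hs.presentsH.faceInterior_eq hd hu]; exact ⟨hn1, hn2⟩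
  rw [this]
  refine MeasurableSet.biUnion (to_countable _) fun v _ => ?_
  refine measurableSet_image_inter continuous_fst (hs.isClosed_contact.inter ?_) ?_
  · exact (isClosed_eq (continuous_dotProduct_left _) continuous_const).prod
      (isClosed_eq (continuous_dotProduct_left _) continuous_const)
  · exact (Presents.isOpen_others S _ v).prod ((Presents.isOpen_others T _ u).inter hO)

/-- A family of open subsets of distinct facets of `Δ_h^∨` has at most the mass of its
transport. -/
theorem nuN_iUnion_le (hs : Setting Δ h Ψ S T) (O : (Fin (d + 1) → ℤ) → Set (Fin (d + 1) → ℝ))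
    (hO : ∀ u, IsOpen (O u)) :
    nuN Δ h (⋃ u : {u // IsFacetNormal (dualH Δ h) u}, faceInterior (dualH Δ h) u.1 ∩ O u.1) ≤
      muM Δ (⋃ u : {u // IsFacetNormal (dualH Δ h) u},
        transport Δ h Ψ u.1 (faceInterior (dualH Δ h) u.1 ∩ O u.1)) := by
  have hd := hs.one_le
  refine (measure_iUnion_le _).trans ?_
  rw [measure_iUnion₀]
  · refine ENNReal.tsum_le_tsum fun u => hs.nuN_le_muM_transport u.2 ?_ inter_subset_left
    exact (hs.presentsH.measurableSet_faceInterior hd u.2).inter (hO u.1).measurableSet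
  · intro u u' hne
    exact hs.muM_transport_inter u.2 u'.2 inter_subset_left inter_subset_left
      ((hs.presentsH.faceInterior_disjoint hd u.2 u'.2 fun he => hne (Subtype.ext he)).mono
        inter_subset_left inter_subset_left)
  · exact fun u => (hs.measurableSet_transport u.2 (hO u.1)).nullMeasurableSet

end Setting

/-- Exhibits the open facet as a relatively open subset of the boundary. -/
theorem Presents.faceInterior_eq_frontier_inter
    {P : Set (Fin (d + 1) → ℝ)} {S : Finset (Fin (d + 1) → ℤ)}
    {h : (Fin (d + 1) → ℤ) → ℝ} (hP : Presents P S h) (hd : 1 ≤ d) {u : Fin (d + 1) → ℤ}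
    (hu : IsFacetNormal P u) :
    faceInterior P u = frontier P ∩ {x | ∀ m ∈ S, m ≠ u → toR m ⬝ᵥ x < h m} := by
  refine Subset.antisymm (fun x hx => ⟨hP.faceInterior_subset_frontier hd hu hx, ?_⟩) ?_
  · rw [hP.faceInterior_eq hd hu] at hx; exact hx.2
  · rintro x ⟨hx, hx'⟩
    obtain ⟨-, m, hm, ht⟩ := hP.mem_frontier_iff.1 hx
    rw [hP.faceInterior_eq hd hu]
    refine ⟨?_, hx'⟩
    by_cases hmu : m = u
    · rw [← hmu, ht]
    · exact absurd ht (hx' m hm hmu).ne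

/-! ### Chart domains and the separation of `B ∖ Σ_Ψ` -/

namespace Setting

variable {Δ : Set (Fin (d + 1) → ℝ)} {h : (Fin (d + 1) → ℤ) → ℤ} {Ψ : (Fin (d + 1) → ℝ) → ℝ}
  {S T : Finset (Fin (d + 1) → ℤ)}

/-- The image is the projection of a compact set of pairs, since `A ∖ σ°` and `B` are compact and
`Ψ^c` is continuous. Thus `U_σ` is open in `B`. -/
theorem isClosed_image_cGradient (hs : Setting Δ h Ψ S T) {v : Fin (d + 1) → ℤ}
    (hv : IsFacetNormal Δ v) :
    IsClosed (⋃ m ∈ frontier Δ \ faceInterior Δ v, cGradient Δ h (cTransform Δ h Ψ) m) := by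
  have hd := hs.one_le
  have hcompact : IsCompact (frontier Δ \ faceInterior Δ v) := by
    have : frontier Δ \ faceInterior Δ v =
        frontier Δ ∩ {x | ∀ m ∈ S, m ≠ v → toR m ⬝ᵥ x < 1}ᶜ := by
      rw [hs.presents.faceInterior_eq_frontier_inter hd hv]
      ext x; simp only [mem_sdiff, mem_inter_iff, mem_compl_iff]; tauto
    rw [this]
    exact hs.presents.isCompact_frontier.inter_right
      (Presents.isOpen_others S (fun _ => 1) v).isClosed_compl
  have hclosed : IsClosed {q : (Fin (d + 1) → ℝ) × (Fin (d + 1) → ℝ) |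
      ∀ m' ∈ frontier Δ, cTransform Δ h Ψ q.1 + (m' - q.1) ⬝ᵥ q.2 ≤ cTransform Δ h Ψ m'} := by
    simp only [ofPred_forall]
    refine isClosed_biInter fun m' _ => isClosed_le ?_ continuous_const
    have hdot : Continuous fun q : (Fin (d + 1) → ℝ) × (Fin (d + 1) → ℝ) => (m' - q.1) ⬝ᵥ q.2 := by
      unfold dotProduct; fun_prop
    exact (hs.continuous_cTransform.comp continuous_fst).add hdot
  have := (((hcompact.prod hs.presentsH.isCompact_frontier).inter_right hclosed).image
    continuous_snd).isClosed
  convert this using 1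
  ext n
  simp only [mem_iUnion, exists_prop]
  constructor
  · rintro ⟨p, hp, hn, hmax⟩
    exact ⟨(p, n), ⟨⟨hp, hn⟩, hmax⟩, rfl⟩
  · rintro ⟨⟨p, n⟩, ⟨⟨hp, hn⟩, hmax⟩, rfl⟩
    exact ⟨p, hp, hn, hmax⟩

theorem frontier_nonempty (hs : Setting Δ h Ψ S T) : (frontier Δ).Nonempty := by
  obtain ⟨u, hu, ⟨x, hx⟩, -⟩ := hs.presents.exists_facet_nonneg hs.one_le 0
  exact ⟨x, hs.presents.faceInterior_subset_frontier hs.one_le hu hx⟩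

/-- By compactness of `A`, every `n ∈ B` is a `c`-subgradient of `Ψ^c` at some `p ∈ A`. If `n ∈
U_σ`, that `p` must lie in `σ°`, and the open facets are disjoint. -/
theorem chartDomain_disjoint (hs : Setting Δ h Ψ S T) {v v' : Fin (d + 1) → ℤ}
    (hv : IsFacetNormal Δ v) (hv' : IsFacetNormal Δ v') (hne : v ≠ v') :
    Disjoint (chartDomain Δ h Ψ v) (chartDomain Δ h Ψ v') := by
  rw [Set.disjoint_left]
  rintro n ⟨hn, hnv⟩ ⟨-, hnv'⟩
  have hcont : Continuous fun p => p ⬝ᵥ n - cTransform Δ h Ψ p := by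
    refine Continuous.sub ?_ hs.continuous_cTransform
    unfold dotProduct; fun_prop
  obtain ⟨p, hp, hmax⟩ := hs.presents.isCompact_frontier.exists_isMaxOn hs.frontier_nonempty
    hcont.continuousOn
  have hpn : n ∈ cGradient Δ h (cTransform Δ h Ψ) p := by
    refine ⟨hn, fun m' hm' => ?_⟩
    have : m' ⬝ᵥ n - cTransform Δ h Ψ m' ≤ p ⬝ᵥ n - cTransform Δ h Ψ p := hmax hm'
    rw [sub_dotProduct]
    linarith
  have key : ∀ w, (n ∉ ⋃ m ∈ frontier Δ \ faceInterior Δ w,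
      cGradient Δ h (cTransform Δ h Ψ) m) → p ∈ faceInterior Δ w := fun w hw => by
    by_contra hpw
    exact hw (mem_iUnion₂.2 ⟨p, ⟨hp, hpw⟩, hpn⟩)
  exact Set.disjoint_left.1 (hs.presents.faceInterior_disjoint hs.one_le hv hv' hne)
    (key v hnv) (key v' hnv')

theorem faceInterior_inter_chartDomain (hs : Setting Δ h Ψ S T) {u v : Fin (d + 1) → ℤ}
    (hu : IsFacetNormal (dualH Δ h) u) :
    faceInterior (dualH Δ h) u ∩ chartDomain Δ h Ψ v = faceInterior (dualH Δ h) u ∩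
      (⋃ m ∈ frontier Δ \ faceInterior Δ v, cGradient Δ h (cTransform Δ h Ψ) m)ᶜ := by
  have := hs.presentsH.faceInterior_subset_frontier hs.one_le hu
  ext n
  exact ⟨fun hn => ⟨hn.1, hn.2.2⟩, fun hn => ⟨hn.1, this hn.1, hn.2⟩⟩

theorem transport_chartDomain_subset (hs : Setting Δ h Ψ S T) {u v : Fin (d + 1) → ℤ} :
    transport Δ h Ψ u (faceInterior (dualH Δ h) u ∩ chartDomain Δ h Ψ v) ⊆
      {p | p ∈ faceInterior Δ v} := by
  rintro p ⟨v', hv', -, hp, n, ⟨-, hn⟩, hc⟩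
  by_contra hpv
  exact hn.2 (mem_iUnion₂.2 ⟨p, ⟨hs.presents.faceInterior_subset_frontier hs.one_le hv' hp, hpv⟩,
    hs.mem_cGradient_of_contact hc⟩)

theorem muM_univ_lt_top (hs : Setting Δ h Ψ S T) : muM Δ univ < ∞ :=
  hs.presents.integralMeasure_univ_lt_top hs.one_le

theorem ratio_ne_zero (hs : Setting Δ h Ψ S T) :
    muM Δ (frontier Δ) / integralMeasure (dualH Δ h) (frontier (dualH Δ h)) ≠ 0 :=
  ENNReal.div_ne_zero.2 ⟨(hs.presents.integralMeasure_frontier_pos hs.one_le).ne',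
    ((measure_mono (subset_univ _)).trans_lt
      (hs.presentsH.integralMeasure_univ_lt_top hs.one_le)).ne⟩

theorem nuN_pos (hs : Setting Δ h Ψ S T) {X : Set (Fin (d + 1) → ℝ)} :
    0 < nuN Δ h X ↔ 0 < integralMeasure (dualH Δ h) X := by
  rw [nuN, Measure.smul_apply, smul_eq_mul, pos_iff_ne_zero, pos_iff_ne_zero, mul_ne_zero_iff]
  exact and_iff_right hs.ratio_ne_zero

theorem nuN_frontier (hs : Setting Δ h Ψ S T) :
    nuN Δ h (frontier (dualH Δ h)) = muM Δ (frontier Δ) := by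
  rw [nuN, Measure.smul_apply, smul_eq_mul]
  exact ENNReal.div_mul_cancel (hs.presentsH.integralMeasure_frontier_pos hs.one_le).ne'
    ((measure_mono (subset_univ _)).trans_lt
      (hs.presentsH.integralMeasure_univ_lt_top hs.one_le)).ne

theorem nuN_mono_openFacets (hs : Setting Δ h Ψ S T) {X Y : Set (Fin (d + 1) → ℝ)}
    (hXY : X ∩ openFacets (dualH Δ h) ⊆ Y) : nuN Δ h X ≤ nuN Δ h Y := by
  rw [nuN, Measure.smul_apply, Measure.smul_apply, smul_eq_mul, smul_eq_mul]
  exact mul_le_mul_right (hs.presentsH.integralMeasure_mono_openFacets hs.one_le hXY) _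

theorem nuN_lt_top (hs : Setting Δ h Ψ S T) (X : Set (Fin (d + 1) → ℝ)) : nuN Δ h X < ∞ := by
  refine (hs.nuN_mono_openFacets (inter_subset_right.trans
    (hs.presentsH.openFacets_subset_frontier hs.one_le))).trans_lt ?_
  rw [hs.nuN_frontier]
  exact (measure_mono (subset_univ _)).trans_lt hs.muM_univ_lt_top

theorem nuN_inter_chartDomain_pos (hs : Setting Δ h Ψ S T) {u v : Fin (d + 1) → ℤ}
    (hu : IsFacetNormal (dualH Δ h) u) (hv : IsFacetNormal Δ v)
    (hne : (faceInterior (dualH Δ h) u ∩ chartDomain Δ h Ψ v).Nonempty) :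
    0 < nuN Δ h (faceInterior (dualH Δ h) u ∩ chartDomain Δ h Ψ v) := by
  rw [hs.nuN_pos]
  rw [hs.faceInterior_inter_chartDomain hu] at hne ⊢
  exact hs.presentsH.integralMeasure_pos hs.one_le hu
    (hs.isClosed_image_cGradient hv).isOpen_compl hne

theorem measurableSet_inter_chartDomain (hs : Setting Δ h Ψ S T) {u v : Fin (d + 1) → ℤ}
    (hu : IsFacetNormal (dualH Δ h) u) (hv : IsFacetNormal Δ v) :
    MeasurableSet (faceInterior (dualH Δ h) u ∩ chartDomain Δ h Ψ v) := by
  rw [hs.faceInterior_inter_chartDomain hu]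
  exact (hs.presentsH.measurableSet_faceInterior hs.one_le hu).inter
    (hs.isClosed_image_cGradient hv).isOpen_compl.measurableSet

/-- The intersection is open in the facet and has positive mass. Its transport is nonempty, lies in
the facet `v`, and by construction only uses facets pairing to 1 with `u`. -/
theorem pairing_eq_one (hs : Setting Δ h Ψ S T) {u v : Fin (d + 1) → ℤ}
    (hu : IsFacetNormal (dualH Δ h) u) (hv : IsFacetNormal Δ v)
    (hne : (faceInterior (dualH Δ h) u ∩ chartDomain Δ h Ψ v).Nonempty) : v ⬝ᵥ u = 1 := by
  have hpos := (hs.nuN_inter_chartDomain_pos hu hv hne).trans_le (hs.nuN_le_muM_transport hu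
    (hs.measurableSet_inter_chartDomain hu hv) inter_subset_left)
  obtain ⟨p, hp⟩ := nonempty_of_measure_ne_zero hpos.ne'
  have hpv := hs.transport_chartDomain_subset hp
  obtain ⟨v', hv', hvu, hp', -⟩ := hp
  by_cases hvv : v' = v
  · rwa [← hvv]
  · exact absurd hpv (Set.disjoint_left.1
      (hs.presents.faceInterior_disjoint hs.one_le hv' hv hvv) hp')

/-- Open facets are pairwise disjoint and so are charts; the only links are facets meeting charts. A
labelling `U`, `V` that respects these links splits the space into two relatively open pieces. -/
theorem not_isPreconnected_of_partition (hs : Setting Δ h Ψ S T) {U V : Set (Fin (d + 1) → ℤ)}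
    (hUV : ∀ u v, IsFacetNormal (dualH Δ h) u → IsFacetNormal Δ v →
      (faceInterior (dualH Δ h) u ∩ chartDomain Δ h Ψ v).Nonempty → (u ∈ U ↔ v ∈ V))
    (h₁ : ∃ u, IsFacetNormal (dualH Δ h) u ∧ u ∈ U)
    (h₂ : ∃ u, IsFacetNormal (dualH Δ h) u ∧ u ∉ U) :
    ¬ IsPreconnected (frontier (dualH Δ h) \ singularSet Δ h Ψ) := by
  have hd := hs.one_le
  intro hpre
  -- An ambient open set whose trace on `B` is the union of the open facets labelled by `U` and the
  -- charts labelled by `V`.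
  let O : Set (Fin (d + 1) → ℤ) → Set (Fin (d + 1) → ℤ) → Set (Fin (d + 1) → ℝ) := fun U V =>
    (⋃ u ∈ {u | IsFacetNormal (dualH Δ h) u ∧ u ∈ U},
      {x | ∀ m ∈ T, m ≠ u → toR m ⬝ᵥ x < h m}) ∪
    ⋃ v ∈ {v | IsFacetNormal Δ v ∧ v ∈ V},
      (⋃ m ∈ frontier Δ \ faceInterior Δ v, cGradient Δ h (cTransform Δ h Ψ) m)ᶜ
  have hO : ∀ U V, IsOpen (O U V) := fun U V =>
    (isOpen_biUnion fun u _ => Presents.isOpen_others T (fun m => (h m : ℝ)) u).union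
      (isOpen_biUnion fun v hv => (hs.isClosed_image_cGradient hv.1).isOpen_compl)
  have hOmem : ∀ U V x, x ∈ frontier (dualH Δ h) → x ∈ O U V →
      (∃ u, IsFacetNormal (dualH Δ h) u ∧ u ∈ U ∧ x ∈ faceInterior (dualH Δ h) u) ∨
      ∃ v, IsFacetNormal Δ v ∧ v ∈ V ∧ x ∈ chartDomain Δ h Ψ v := by
    rintro U V x hx (hxO | hxO)
    · obtain ⟨u, ⟨hu, huU⟩, hxu⟩ := mem_iUnion₂.1 hxO
      refine Or.inl ⟨u, hu, huU, ?_⟩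
      rw [hs.presentsH.faceInterior_eq_frontier_inter hd hu]
      exact ⟨hx, hxu⟩
    · obtain ⟨v, ⟨hv, hvV⟩, hxv⟩ := mem_iUnion₂.1 hxO
      exact Or.inr ⟨v, hv, hvV, hx, hxv⟩
  have hfacet : ∀ U V u x, IsFacetNormal (dualH Δ h) u → u ∈ U →
      x ∈ faceInterior (dualH Δ h) u → x ∈ O U V := by
    intro U V u x hu huU hx
    rw [hs.presentsH.faceInterior_eq_frontier_inter hd hu] at hx
    exact Or.inl (mem_iUnion₂.2 ⟨u, ⟨hu, huU⟩, hx.2⟩)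
  have hregular : ∀ u x, IsFacetNormal (dualH Δ h) u → x ∈ faceInterior (dualH Δ h) u →
      x ∈ frontier (dualH Δ h) \ singularSet Δ h Ψ := fun u x hu hx =>
    ⟨hs.presentsH.faceInterior_subset_frontier hd hu hx,
      fun hsing => hsing.1.2 (mem_iUnion₂.2 ⟨u, hu, hx⟩)⟩
  have hcover : frontier (dualH Δ h) \ singularSet Δ h Ψ ⊆ O U V ∪ O Uᶜ Vᶜ := by
    rintro x ⟨hx, hxs⟩
    by_cases hxo : x ∈ openFacets (dualH Δ h)
    · obtain ⟨u, hu, hxu⟩ := mem_iUnion₂.1 hxo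
      by_cases huU : u ∈ U
      · exact Or.inl (hfacet _ _ u x hu huU hxu)
      · exact Or.inr (hfacet _ _ u x hu huU hxu)
    · obtain ⟨v, hv, hxv⟩ : ∃ v, IsFacetNormal Δ v ∧ x ∈ chartDomain Δ h Ψ v := by
        by_contra hcon
        push Not at hcon
        refine hxs ⟨⟨hx, hxo⟩, fun hmem => ?_⟩
        obtain ⟨v, hv, hxv⟩ := mem_iUnion₂.1 hmem
        exact hcon v hv hxv
      by_cases hvV : v ∈ V
      · exact Or.inl (Or.inr (mem_iUnion₂.2 ⟨v, ⟨hv, hvV⟩, hxv.2⟩))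
      · exact Or.inr (Or.inr (mem_iUnion₂.2 ⟨v, ⟨hv, hvV⟩, hxv.2⟩))
  obtain ⟨u₁, hu₁, huU₁⟩ := h₁
  obtain ⟨u₂, hu₂, huU₂⟩ := h₂
  obtain ⟨x₁, hx₁⟩ := hs.presentsH.faceInterior_nonempty hd hu₁
  obtain ⟨x₂, hx₂⟩ := hs.presentsH.faceInterior_nonempty hd hu₂
  obtain ⟨x, ⟨hxB, -⟩, hxO, hxO'⟩ := hpre _ _ (hO U V) (hO Uᶜ Vᶜ) hcover
    ⟨x₁, hregular u₁ x₁ hu₁ hx₁, hfacet _ _ u₁ x₁ hu₁ huU₁ hx₁⟩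
    ⟨x₂, hregular u₂ x₂ hu₂ hx₂, hfacet _ _ u₂ x₂ hu₂ huU₂ hx₂⟩
  rcases hOmem _ _ x hxB hxO with ⟨u, hu, huU, hxu⟩ | ⟨v, hv, hvV, hxv⟩ <;>
    rcases hOmem _ _ x hxB hxO' with ⟨u', hu', huU', hxu'⟩ | ⟨v', hv', hvV', hxv'⟩
  · refine Set.disjoint_left.1 (hs.presentsH.faceInterior_disjoint hd hu hu' ?_) hxu hxu'
    rintro rfl; exact huU' huU
  · exact hvV' ((hUV u v' hu hv' ⟨x, hxu, hxv'⟩).1 huU)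
  · exact huU' ((hUV u' v hu' hv ⟨x, hxu', hxv⟩).2 hvV)
  · refine Set.disjoint_left.1 (hs.chartDomain_disjoint hv hv' ?_) hxv hxv'
    rintro rfl; exact hvV' hvV

theorem mem_star (hs : Setting Δ h Ψ S T) {u v : Fin (d + 1) → ℤ} (hv : IsFacetNormal Δ v)
    (hu : toR u ∈ Δ) (hvu : v ⬝ᵥ u = 1) {p : Fin (d + 1) → ℝ} (hp : p ∈ faceInterior Δ v) :
    p ∈ star Δ (toR u) := by
  have hface := hs.presents.face_eq hs.one_le hv
  refine ⟨face Δ v, fun _ => ⟨(dotLin (toR v)).toContinuousLinearMap, rfl⟩, fun he => ?_,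
    hface.ge ⟨hu, by rw [toR_dotProduct_toR, hvu]; simp⟩, intrinsicInterior_subset hp⟩
  have h0 : (0 : Fin (d + 1) → ℝ) ∈ face Δ v := by rw [he]; exact hs.presents.zero_mem
  rw [hface] at h0
  simpa using h0.2

/-- If a facet `u ≠ u₀` met the chart of some `v` with `⟨v, u₀⟩ = 1`, then the facet `u₀` together
with this piece of positive mass would be transported into the star of `u₀`, exceeding its mass. -/
theorem not_isPreconnected_of_star (hs : Setting Δ h Ψ S T) {u₀ : Fin (d + 1) → ℤ}
    (hu₀ : IsFacetNormal (dualH Δ h) u₀)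
    (heq : nuN Δ h (face (dualH Δ h) u₀) = muM Δ (star Δ (toR u₀))) :
    ¬ IsPreconnected (frontier (dualH Δ h) \ singularSet Δ h Ψ) := by
  classical
  have hd := hs.one_le
  refine hs.not_isPreconnected_of_partition (U := {u₀}) (V := {v | v ⬝ᵥ u₀ = 1})
    (fun u v hu hv hne => ⟨?_, ?_⟩) ⟨u₀, hu₀, rfl⟩ ?_
  · rintro rfl
    exact hs.pairing_eq_one hu hv hne
  · intro hvu₀
    by_contra huu₀
    replace huu₀ : u ≠ u₀ := huu₀
    have hpos := hs.nuN_inter_chartDomain_pos hu hv hne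
    have hmeas := hs.measurableSet_inter_chartDomain hu hv
    -- The family is the whole facet `u₀`, the part of the facet `u` in the chart of `v`, and
    -- nothing elsewhere.
    have hle := hs.nuN_iUnion_le (fun w => if w = u₀ then univ else if w = u then
      (⋃ m ∈ frontier Δ \ faceInterior Δ v, cGradient Δ h (cTransform Δ h Ψ) m)ᶜ else ∅) fun w => by
        split_ifs
        · exact isOpen_univ
        · exact (hs.isClosed_image_cGradient hv).isOpen_compl
        · exact isOpen_empty
    have hright : muM Δ (⋃ w : {u // IsFacetNormal (dualH Δ h) u}, transport Δ h Ψ w.1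
        (faceInterior (dualH Δ h) w.1 ∩ if w.1 = u₀ then univ else if w.1 = u then
        (⋃ m ∈ frontier Δ \ faceInterior Δ v, cGradient Δ h (cTransform Δ h Ψ) m)ᶜ else ∅)) ≤
        muM Δ (star Δ (toR u₀)) := by
      refine measure_mono (iUnion_subset fun w p hp => ?_)
      by_cases hw : w.1 = u₀
      · obtain ⟨v', hv', hvw, hpv, -⟩ := hp
        exact hs.mem_star hv' (hs.mem_of_facet hu₀) (hw ▸ hvw) hpv
      · rw [if_neg hw] at hp
        by_cases hw' : w.1 = u
        · rw [if_pos hw', ← hs.faceInterior_inter_chartDomain w.2] at hp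
          exact hs.mem_star hv (hs.mem_of_facet hu₀) hvu₀ (hs.transport_chartDomain_subset hp)
        · rw [if_neg hw', inter_empty] at hp
          obtain ⟨_, _, _, _, _, hn, _⟩ := hp
          exact hn.elim
    have hleft : nuN Δ h (face (dualH Δ h) u₀) +
        nuN Δ h (faceInterior (dualH Δ h) u ∩ chartDomain Δ h Ψ v) ≤
        nuN Δ h (⋃ w : {u // IsFacetNormal (dualH Δ h) u}, faceInterior (dualH Δ h) w.1 ∩
        if w.1 = u₀ then univ else if w.1 = u then
        (⋃ m ∈ frontier Δ \ faceInterior Δ v, cGradient Δ h (cTransform Δ h Ψ) m)ᶜ else ∅) := by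
      refine (add_le_add_left (hs.nuN_mono_openFacets
        (hs.presentsH.face_inter_openFacets hd hu₀)) _).trans ?_
      rw [← measure_union ((hs.presentsH.faceInterior_disjoint hd hu₀ hu huu₀.symm).mono_right
        inter_subset_left) hmeas, hs.faceInterior_inter_chartDomain hu]
      refine measure_mono (union_subset (fun x hx => ?_) fun x hx => ?_)
      · exact mem_iUnion.2 ⟨⟨u₀, hu₀⟩, by simpa using hx⟩
      · exact mem_iUnion.2 ⟨⟨u, hu⟩, by simpa [huu₀] using hx⟩
    have := hleft.trans (hle.trans hright)
    rw [← heq] at this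
    exact (ENNReal.lt_add_right (hs.nuN_lt_top _).ne hpos.ne').not_ge this
  -- A normal pairing nonnegatively with `-u₀` cannot be `u₀`, so the second class is nonempty.
  · obtain ⟨u, hu, -, h0⟩ := hs.presentsH.exists_facet_nonneg hd (-toR u₀)
    refine ⟨u, hu, ?_⟩
    rintro rfl
    have := dotProduct_self_pos (toR_ne_zero hu₀.1.ne_zero)
    rw [dotProduct_neg] at h0
    linarith

/-- Total masses agree, so equality on `σ` bounds the mass of `A ∖ σ` by that of the facets `w` with
`⟨v₀, w⟩ ≠ 1`. These are transported into `A ∖ σ`. If a facet `u` with `⟨v₀, u⟩ = 1` met another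
chart, that piece would add positive mass there. -/
theorem not_isPreconnected_of_dualStar (hs : Setting Δ h Ψ S T) {v₀ : Fin (d + 1) → ℤ}
    (hv₀ : IsFacetNormal Δ v₀) (heq : muM Δ (face Δ v₀) = nuN Δ h (dualStar Δ h v₀)) :
    ¬ IsPreconnected (frontier (dualH Δ h) \ singularSet Δ h Ψ) := by
  classical
  have hd := hs.one_le
  have hface := hs.presents.face_eq hd hv₀
  have hfacemem : ∀ m : Fin (d + 1) → ℤ, toR m ∈ face Δ v₀ ↔ toR m ∈ Δ ∧ v₀ ⬝ᵥ m = 1 := by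
    intro m
    rw [hface]
    refine and_congr_right fun _ => ?_
    rw [toR_dotProduct_toR]
    exact_mod_cast Iff.rfl
  have hnotface : ∀ v p, IsFacetNormal Δ v → v ≠ v₀ → p ∈ faceInterior Δ v →
      p ∈ frontier Δ \ face Δ v₀ := by
    intro v p hv hne hp
    refine ⟨hs.presents.faceInterior_subset_frontier hd hv hp, fun hp' => ?_⟩
    rw [hs.presents.faceInterior_eq hd hv] at hp
    rw [hface] at hp'
    exact (hp.2 v₀ (hs.presents.mem_of_isFacetNormal hd hv₀) hne.symm).ne hp'.2
  refine hs.not_isPreconnected_of_partition (U := {u | v₀ ⬝ᵥ u = 1}) (V := {v₀})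
    (fun u v hu hv hne => ⟨?_, ?_⟩) ?_ ?_
  · intro hvu₀
    by_contra hvv₀
    replace hvv₀ : v ≠ v₀ := hvv₀
    replace hvu₀ : v₀ ⬝ᵥ u = 1 := hvu₀
    have hpos := hs.nuN_inter_chartDomain_pos hu hv hne
    have hmeas := hs.measurableSet_inter_chartDomain hu hv
    set Y : Set (Fin (d + 1) → ℝ) :=
      ⋃ w ∈ {w | IsFacetNormal (dualH Δ h) w ∧ v₀ ⬝ᵥ w ≠ 1}, faceInterior (dualH Δ h) w with hY
    have hle := hs.nuN_iUnion_le (fun w => if w = u then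
      (⋃ m ∈ frontier Δ \ faceInterior Δ v, cGradient Δ h (cTransform Δ h Ψ) m)ᶜ else
      if v₀ ⬝ᵥ w = 1 then ∅ else univ) fun w => by
        split_ifs
        · exact (hs.isClosed_image_cGradient hv).isOpen_compl
        · exact isOpen_empty
        · exact isOpen_univ
    have hright : muM Δ (⋃ w : {u // IsFacetNormal (dualH Δ h) u}, transport Δ h Ψ w.1
        (faceInterior (dualH Δ h) w.1 ∩ if w.1 = u then
        (⋃ m ∈ frontier Δ \ faceInterior Δ v, cGradient Δ h (cTransform Δ h Ψ) m)ᶜ else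
        if v₀ ⬝ᵥ w.1 = 1 then ∅ else univ)) ≤ muM Δ (frontier Δ \ face Δ v₀) := by
      refine measure_mono (iUnion_subset fun w p hp => ?_)
      by_cases hw : w.1 = u
      · rw [if_pos hw, ← hs.faceInterior_inter_chartDomain w.2] at hp
        exact hnotface v p hv hvv₀ (hs.transport_chartDomain_subset hp)
      · rw [if_neg hw] at hp
        by_cases hw' : v₀ ⬝ᵥ w.1 = 1
        · rw [if_pos hw', inter_empty] at hp
          obtain ⟨_, _, _, _, _, hn, _⟩ := hp
          exact hn.elim
        · obtain ⟨v', hv', hvw, hpv, -⟩ := hp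
          refine hnotface v' p hv' ?_ hpv
          rintro rfl
          exact hw' hvw
    have hleft : nuN Δ h Y + nuN Δ h (faceInterior (dualH Δ h) u ∩ chartDomain Δ h Ψ v) ≤
        nuN Δ h (⋃ w : {u // IsFacetNormal (dualH Δ h) u}, faceInterior (dualH Δ h) w.1 ∩
        if w.1 = u then
        (⋃ m ∈ frontier Δ \ faceInterior Δ v, cGradient Δ h (cTransform Δ h Ψ) m)ᶜ else
        if v₀ ⬝ᵥ w.1 = 1 then ∅ else univ) := by
      have hYE : Disjoint Y (faceInterior (dualH Δ h) u ∩ chartDomain Δ h Ψ v) := by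
        rw [Set.disjoint_left]
        intro x hx hx'
        obtain ⟨w, ⟨hw, hvw⟩, hxw⟩ := mem_iUnion₂.1 hx
        refine Set.disjoint_left.1 (hs.presentsH.faceInterior_disjoint hd hw hu ?_) hxw hx'.1
        rintro rfl
        exact hvw hvu₀
      rw [← measure_union hYE hmeas, hs.faceInterior_inter_chartDomain hu]
      refine measure_mono (union_subset (fun x hx => ?_) fun x hx => ?_)
      · obtain ⟨w, ⟨hw, hvw⟩, hxw⟩ := mem_iUnion₂.1 hx
        have hwu : w ≠ u := by rintro rfl; exact hvw hvu₀
        exact mem_iUnion.2 ⟨⟨w, hw⟩, by simpa [hwu, hvw] using hxw⟩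
      · exact mem_iUnion.2 ⟨⟨u, hu⟩, by simpa using hx⟩
    have hclosed : MeasurableSet (face Δ v₀) := by
      rw [hface]
      exact hs.presents.isClosed.measurableSet.inter
        (isClosed_eq (continuous_dotProduct_left _) continuous_const).measurableSet
    -- Every open facet of `dualH Δ h` lies either in the dual star of `σ` or in `Y`, so the two
    -- masses together dominate that of `B`, equal to that of `A`.
    have htotal : muM Δ (face Δ v₀) + muM Δ (frontier Δ \ face Δ v₀) ≤ muM Δ (face Δ v₀) +
        nuN Δ h Y := by
      rw [← measure_union' disjoint_sdiff_self_right hclosed]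
      have h1 : face Δ v₀ ∪ frontier Δ \ face Δ v₀ ⊆ frontier Δ := by
        refine union_subset (fun x hx => ?_) sdiff_subset
        rw [hface] at hx
        exact hs.presents.mem_frontier_iff.2
          ⟨hx.1, v₀, hs.presents.mem_of_isFacetNormal hd hv₀, hx.2⟩
      refine (measure_mono h1).trans ?_
      rw [← hs.nuN_frontier, heq]
      refine (hs.nuN_mono_openFacets (Y := dualStar Δ h v₀ ∪ Y) ?_).trans (measure_union_le _ _)
      rintro x ⟨-, hx⟩
      obtain ⟨w, hw, hxw⟩ := mem_iUnion₂.1 hx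
      by_cases hvw : v₀ ⬝ᵥ w = 1
      · refine Or.inl (mem_iUnion₂.2 ⟨w, (hfacemem w).2 ⟨hs.mem_of_facet hw, hvw⟩, ?_⟩)
        rw [hs.presentsH.faceInterior_eq hd hw] at hxw
        exact ⟨hs.presentsH.tightOnly_subset hxw, hxw.1⟩
      · exact Or.inr (mem_iUnion₂.2 ⟨w, ⟨hw, hvw⟩, hxw⟩)
    have hfin : muM Δ (face Δ v₀) ≠ ∞ :=
      ((measure_mono (subset_univ _)).trans_lt hs.muM_univ_lt_top).ne
    have := hleft.trans (hle.trans (hright.trans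
      ((ENNReal.add_le_add_iff_left hfin).1 htotal)))
    exact (ENNReal.lt_add_right (hs.nuN_lt_top _).ne hpos.ne').not_ge this
  · rintro rfl
    exact hs.pairing_eq_one hu hv hne
  · by_contra hcon
    push Not at hcon
    -- With no facet in the first class, the dual star misses all open facets and is null, although
    -- the facet `v₀` has positive mass.
    have hzero : nuN Δ h (dualStar Δ h v₀) ≤ nuN Δ h ∅ := by
      refine hs.nuN_mono_openFacets ?_
      rintro x ⟨hx, hxo⟩
      obtain ⟨m, hm, hxm⟩ := mem_iUnion₂.1 hx
      obtain ⟨w, hw, hxw⟩ := mem_iUnion₂.1 hxo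
      obtain ⟨hmΔ, hvm⟩ := (hfacemem m).1 hm
      have hmT : m ∈ T := (hs.mem_iff m).2 ⟨hmΔ, by rintro rfl; simp at hvm⟩
      rw [hs.presentsH.faceInterior_eq hd hw] at hxw
      by_cases hmw : m = w
      · exact hcon w hw (hmw ▸ hvm)
      · exact absurd hxm.2 (hxw.2 m hmT hmw).ne
    rw [measure_empty, ← heq] at hzero
    have hpos := hs.presents.integralMeasure_pos hd hv₀ isOpen_univ
      (by simpa using hs.presents.faceInterior_nonempty hd hv₀)
    rw [inter_univ] at hpos
    exact (hpos.trans_le (measure_mono intrinsicInterior_subset)).not_ge hzero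
  · obtain ⟨u, hu, -, h0⟩ := hs.presentsH.exists_facet_nonneg hd (-toR v₀)
    refine ⟨u, hu, fun hvu => ?_⟩
    replace hvu : v₀ ⬝ᵥ u = 1 := hvu
    rw [dotProduct_neg, toR_dotProduct_toR, dotProduct_comm, hvu] at h0
    norm_num at h0

end Setting

/-! ### Dimension and connectedness -/

theorem le_finrank_ker_prod (a b : Fin (d + 1) → ℝ) :
    d ≤ Module.finrank ℝ (LinearMap.ker ((dotLin a).prod (dotLin b))) + 1 := by
  have h1 := ((dotLin a).prod (dotLin b)).finrank_range_add_finrank_ker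
  have h2 := Submodule.finrank_le (LinearMap.range ((dotLin a).prod (dotLin b)))
  simp at h1 h2
  omega

namespace Presents

variable {P : Set (Fin (d + 1) → ℝ)} {S : Finset (Fin (d + 1) → ℤ)} {h : (Fin (d + 1) → ℤ) → ℝ}

theorem dimH_doubly_tight_le (hP : Presents P S h) {m m' : Fin (d + 1) → ℤ}
    (hm : m ∈ S) (hm' : m' ∈ S) (hne : m ≠ m') :
    dimH {x | toR m ⬝ᵥ x = h m ∧ toR m' ⬝ᵥ x = h m'} ≤ ((d - 1 : ℕ) : ℝ≥0∞) := by
  rcases eq_empty_or_nonempty {x | toR m ⬝ᵥ x = h m ∧ toR m' ⬝ᵥ x = h m'} with he | ⟨x₀, h₀, h₀'⟩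
  · rw [he, dimH_empty]; exact zero_le
  set W := LinearMap.ker (dotLin (toR m)) ⊓ LinearMap.ker (dotLin (toR m')) with hW
  have hlt : W < LinearMap.ker (dotLin (toR m)) := by
    refine lt_of_le_of_ne inf_le_left fun heq => ?_
    obtain ⟨c, hc⟩ := exists_smul_eq_of_ker_le (a := toR m) (b := toR m') fun x hx => by
      have : x ∈ W := by rw [heq]; simpa using hx
      simpa using this.2
    obtain ⟨w, hw⟩ := hP.unimodular m hm
    obtain ⟨w', hw'⟩ := hP.unimodular m' hm'
    rw [hc, smul_dotProduct, h₀, smul_eq_mul] at h₀'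
    have hc0 : 0 < c := by
      have := hP.pos m' hm'
      rw [← h₀'] at this
      exact pos_of_mul_pos_left this (hP.pos m hm).le
    exact hne (eq_of_smul_eq hw hw' hc0 hc).symm
  have hrank := Submodule.finrank_lt_finrank_of_lt hlt
  rw [finrank_ker_dotLin (toR_ne_zero (hP.ne_zero hm))] at hrank
  have hlip : LipschitzWith 1 fun w : W => x₀ + (w : Fin (d + 1) → ℝ) :=
    LipschitzWith.of_dist_le_mul fun w w' => by
      rw [dist_add_left, NNReal.coe_one, one_mul]; rfl
  have hsub : {x | toR m ⬝ᵥ x = h m ∧ toR m' ⬝ᵥ x = h m'} ⊆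
      range fun w : W => x₀ + (w : Fin (d + 1) → ℝ) := by
    rintro x ⟨hx, hx'⟩
    refine ⟨⟨x - x₀, ?_, ?_⟩, add_sub_cancel _ _⟩
    · simp [dotProduct_sub, hx, h₀]
    · simp [dotProduct_sub, hx', h₀']
  refine (dimH_mono hsub).trans (hlip.dimH_range_le.trans ?_)
  rw [Real.dimH_univ_eq_finrank]
  exact_mod_cast (by omega : Module.finrank ℝ W ≤ d - 1)

/-- Outside the open facets two distinct inequalities are tight, leaving finitely many affine
subspaces of codimension two in the ambient space. -/
theorem dimH_frontier_diff_openFacets_le (hP : Presents P S h) (hd : 1 ≤ d) :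
    dimH (frontier P \ openFacets P) + 1 ≤ d := by
  have key : dimH (frontier P \ openFacets P) ≤ ((d - 1 : ℕ) : ℝ≥0∞) := by
    have hsub : frontier P \ openFacets P ⊆ ⋃ q ∈ {q : (Fin (d + 1) → ℤ) × (Fin (d + 1) → ℤ) |
        (q.1 ∈ S ∧ q.2 ∈ S) ∧ q.1 ≠ q.2},
        {x | toR q.1 ⬝ᵥ x = h q.1 ∧ toR q.2 ⬝ᵥ x = h q.2} := by
      rintro x ⟨hx, hxo⟩
      obtain ⟨hxP, u, hu, hxu⟩ := hP.mem_frontier_iff.1 hx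
      by_contra hcon
      have hxt : x ∈ tightOnly S h u := by
        refine ⟨hxu, fun m hm hmu => lt_of_le_of_ne ((hP.mem_iff x).1 hxP m hm) fun he => ?_⟩
        exact hcon (mem_iUnion₂.2 ⟨(u, m), ⟨⟨hu, hm⟩, hmu.symm⟩, hxu, he⟩)
      have huf := hP.isFacetNormal_of_mem_tightOnly hu hxt
      exact hxo (mem_iUnion₂.2 ⟨u, huf, by rwa [hP.faceInterior_eq hd huf]⟩)
    refine (dimH_mono hsub).trans ?_
    rw [dimH_bUnion (to_countable _)]
    exact iSup₂_le fun q hq => hP.dimH_doubly_tight_le hq.1.1 hq.1.2 hq.2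
  refine (add_le_add_left key 1).trans ?_
  exact_mod_cast (by omega : d - 1 + 1 ≤ d)

theorem continuousOn_radial (hP : Presents P S h) :
    ContinuousOn (fun x => (gauge P x)⁻¹ • x) {0}ᶜ :=
  ((continuous_gauge hP.convex hP.mem_nhds_zero).continuousOn.inv₀
    fun _ hx => (hP.gauge_pos hx).ne').smul continuousOn_id

theorem ne_zero_of_mem_frontier (hP : Presents P S h) {x : Fin (d + 1) → ℝ}
    (hx : x ∈ frontier P) : x ≠ 0 := by
  rintro rfl
  have := (gauge_eq_one_iff_mem_frontier hP.convex hP.mem_nhds_zero).2 hx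
  simp at this

theorem radial_eq_self (hP : Presents P S h) {x : Fin (d + 1) → ℝ}
    (hx : x ∈ frontier P) : (gauge P x)⁻¹ • x = x := by
  rw [(gauge_eq_one_iff_mem_frontier hP.convex hP.mem_nhds_zero).2 hx, inv_one, one_smul]

/-- The boundary is the radial image of the punctured space, connected because `d + 1 ≥ 2`. -/
theorem isPreconnected_frontier (hP : Presents P S h) (hd : 1 ≤ d) :
    IsPreconnected (frontier P) := by
  have h1 : IsPreconnected ({0}ᶜ : Set (Fin (d + 1) → ℝ)) :=
    (isConnected_compl_singleton_of_one_lt_rank (by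
      rw [rank_fin_fun]; exact_mod_cast (by omega : 1 < d + 1)) 0).isPreconnected
  have h2 := h1.image _ hP.continuousOn_radial
  convert h2 using 1
  ext x
  constructor
  · intro hx
    exact ⟨x, hP.ne_zero_of_mem_frontier hx, hP.radial_eq_self hx⟩
  · rintro ⟨y, hy, rfl⟩
    exact hP.inv_gauge_smul_mem_frontier hy

end Presents

/-- The central projection from the line through `x` to the affine subspace
`{z | ⟨a, z⟩ = ⟨b, z⟩ = 1}`, where `⟨a, x⟩ = 0`. -/
def lineProjection (a b x s : Fin (d + 1) → ℝ) : Fin (d + 1) → ℝ :=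
  (a ⬝ᵥ s)⁻¹ • s + ((1 - (b ⬝ᵥ s) * (a ⬝ᵥ s)⁻¹) / (b ⬝ᵥ x)) • x

/-- On the convex set `⟨a, s⟩ > 0` the map is `C¹`, so it does not raise Hausdorff dimension. -/
theorem dimH_lineProjection_le (a b x : Fin (d + 1) → ℝ) {F : Type*} [NormedAddCommGroup F]
    [NormedSpace ℝ F] (π : (Fin (d + 1) → ℝ) →L[ℝ] F) (z₀ : Fin (d + 1) → ℝ)
    (A : Set (Fin (d + 1) → ℝ)) :
    dimH ((fun s => π (lineProjection a b x s - z₀)) '' (A ∩ {s | 0 < a ⬝ᵥ s})) ≤ dimH A := by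
  have hdot : ∀ c : Fin (d + 1) → ℝ, ContDiff ℝ 1 fun s : Fin (d + 1) → ℝ => c ⬝ᵥ s := fun c =>
    (dotLin c).toContinuousLinearMap.contDiff
  have hinv : ContDiffOn ℝ 1 (fun s : Fin (d + 1) → ℝ => (a ⬝ᵥ s)⁻¹) {s | 0 < a ⬝ᵥ s} :=
    (hdot a).contDiffOn.inv fun s hs => (ne_of_gt hs)
  have hproj : ContDiffOn ℝ 1 (lineProjection a b x) {s | 0 < a ⬝ᵥ s} :=
    (hinv.smul contDiffOn_id).add
      (((contDiffOn_const.sub ((hdot b).contDiffOn.mul hinv)).div_const _).smul contDiffOn_const)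
  have := (π.contDiff.comp_contDiffOn (hproj.sub (contDiffOn_const (c := z₀)))).dimH_image_le
    (t := A ∩ {s | 0 < a ⬝ᵥ s}) (convex_halfSpace_gt (dotLin a).isLinear 0) inter_subset_right
  exact this.trans (dimH_mono inter_subset_left)

theorem eq_lineProjection {a b x z s : Fin (d + 1) → ℝ} (hax : a ⬝ᵥ x = 0) (hbx : b ⬝ᵥ x ≠ 0)
    (haz : a ⬝ᵥ z = 1) (hbz : b ⬝ᵥ z = 1) {t l : ℝ} (ht : 0 < t) (hl : 0 < l)
    (hs : s = l • ((1 - t) • x + t • z)) : z = lineProjection a b x s := by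
  have h1 : a ⬝ᵥ s = l * t := by
    rw [hs]; simp only [dotProduct_smul, dotProduct_add, hax, haz, smul_eq_mul]; ring
  have h2 : b ⬝ᵥ s = l * ((1 - t) * (b ⬝ᵥ x) + t) := by
    rw [hs]; simp only [dotProduct_smul, dotProduct_add, hbz, smul_eq_mul]; ring
  have h3 : (l * t)⁻¹ * l * t = 1 := by field_simp
  have h4 : (1 - l * ((1 - t) * (b ⬝ᵥ x) + t) * (l * t)⁻¹) / (b ⬝ᵥ x) +
      (l * t)⁻¹ * l * (1 - t) = 0 := by
    field_simp; ring
  rw [lineProjection, h1, h2, hs]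
  trans ((l * t)⁻¹ * l * t) • z + ((1 - l * ((1 - t) * (b ⬝ᵥ x) + t) * (l * t)⁻¹) / (b ⬝ᵥ x) +
      (l * t)⁻¹ * l * (1 - t)) • x
  · rw [h3, h4, one_smul, zero_smul, add_zero]
  · module

/-! ### Connectedness of the boundary minus a small set -/

namespace Presents

variable {P : Set (Fin (d + 1) → ℝ)} {S : Finset (Fin (d + 1) → ℤ)} {h : (Fin (d + 1) → ℤ) → ℝ}

/-- If the radial image of the segment hits `A` at `s` past `x`, then `z` is recovered from `s` by
`lineProjection`, which the hypothesis forbids. As `⟨a, ·⟩` is positive past `x`, the segment avoids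
the origin. -/
theorem radial_segment_subset (hP : Presents P S h) {A : Set (Fin (d + 1) → ℝ)}
    {a b x z : Fin (d + 1) → ℝ} (hx : x ∈ frontier P \ A)
    (hax : a ⬝ᵥ x = 0) (hbx : b ⬝ᵥ x ≠ 0) (haz : a ⬝ᵥ z = 1) (hbz : b ⬝ᵥ z = 1)
    (hz : ∀ s ∈ A ∩ {s | 0 < a ⬝ᵥ s}, z ≠ lineProjection a b x s) :
    segment ℝ x z ⊆ {0}ᶜ ∧
      (fun x => (gauge P x)⁻¹ • x) '' segment ℝ x z ⊆ frontier P \ A := by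
  have key : ∀ p ∈ segment ℝ x z, p ≠ 0 ∧ (gauge P p)⁻¹ • p ∉ A := by
    rw [segment_eq_image]
    rintro _ ⟨t, ht, rfl⟩
    rcases ht.1.eq_or_lt with rfl | ht0
    · simp only [sub_zero, one_smul, zero_smul, add_zero]
      refine ⟨hP.ne_zero_of_mem_frontier hx.1, ?_⟩
      rw [hP.radial_eq_self hx.1]; exact hx.2
    · have hap : a ⬝ᵥ ((1 - t) • x + t • z) = t := by
        simp only [dotProduct_smul, dotProduct_add, hax, haz, smul_eq_mul]; ring
      have hp0 : (1 - t) • x + t • z ≠ 0 := by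
        intro h0
        rw [h0, dotProduct_zero] at hap
        exact ht0.ne hap
      have hl := inv_pos.2 (hP.gauge_pos hp0)
      refine ⟨hp0, fun hA => hz _ ⟨hA, ?_⟩ (eq_lineProjection hax hbx haz hbz ht0 hl rfl)⟩
      change 0 < a ⬝ᵥ _
      rw [dotProduct_smul, hap]
      exact mul_pos hl ht0
  refine ⟨fun p hp => (key p hp).1, ?_⟩
  rintro _ ⟨p, hp, rfl⟩
  exact ⟨hP.inv_gauge_smul_mem_frontier (key p hp).1, (key p hp).2⟩

/-- Join `x` and `y` by two segments through a point `z` and project radially to the boundary. The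
candidates `z` form an affine space of dimension at least `d - 1`, and the blocked ones are images
of `A` of dimension at most `dimH A`, so some `z` is free for both segments. -/
theorem isPreconnected_frontier_diff (hP : Presents P S h) {A : Set (Fin (d + 1) → ℝ)}
    (hA : dimH A + 1 < d) : IsPreconnected (frontier P \ A) := by
  refine isPreconnected_of_forall_pair fun x hx y hy => ?_
  have hx0 := hP.ne_zero_of_mem_frontier hx.1
  have hy0 := hP.ne_zero_of_mem_frontier hy.1
  have hd : 2 ≤ d := by
    have : (1 : ℝ≥0∞) < d := lt_of_le_of_lt le_add_self hA
    exact_mod_cast this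
  obtain ⟨a, hax, hay, ha0⟩ : ∃ a : Fin (d + 1) → ℝ, a ⬝ᵥ x = 0 ∧ a ⬝ᵥ y = 0 ∧ a ≠ 0 := by
    have hrank := le_finrank_ker_prod x y
    have hne : LinearMap.ker ((dotLin x).prod (dotLin y)) ≠ ⊥ := by
      intro h0
      rw [h0, finrank_bot] at hrank
      omega
    obtain ⟨a, ha, ha0⟩ := Submodule.exists_mem_ne_zero_of_ne_bot hne
    have ha' : x ⬝ᵥ a = 0 ∧ y ⬝ᵥ a = 0 := by simpa using ha
    exact ⟨a, by rw [dotProduct_comm, ha'.1], by rw [dotProduct_comm, ha'.2], ha0⟩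
  obtain ⟨b, hbx, hby⟩ : ∃ b : Fin (d + 1) → ℝ, b ⬝ᵥ x ≠ 0 ∧ b ⬝ᵥ y ≠ 0 := by
    have hxx := (dotProduct_self_pos hx0).ne'
    have hyy := (dotProduct_self_pos hy0).ne'
    by_cases hxy : x ⬝ᵥ y = 0
    · refine ⟨x + y, ?_, ?_⟩
      · rwa [add_dotProduct, dotProduct_comm y x, hxy, add_zero]
      · rwa [add_dotProduct, hxy, zero_add]
    · exact ⟨x, hxx, hxy⟩
  obtain ⟨z₀, haz₀, hbz₀⟩ : ∃ z₀ : Fin (d + 1) → ℝ, a ⬝ᵥ z₀ = 1 ∧ b ⬝ᵥ z₀ = 1 := by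
    have haa := (dotProduct_self_pos ha0).ne'
    refine ⟨(a ⬝ᵥ a)⁻¹ • a + ((1 - (a ⬝ᵥ a)⁻¹ * (b ⬝ᵥ a)) / (b ⬝ᵥ x)) • x, ?_, ?_⟩
    · simp [dotProduct_add, dotProduct_smul, hax, haa]
    · simp [dotProduct_add, dotProduct_smul, hbx]
  set W := LinearMap.ker ((dotLin a).prod (dotLin b)) with hW
  -- The retraction `π` moves the blocked points into `W`, where their dimension can be compared
  -- with that of the space of candidates.
  obtain ⟨π, hπ⟩ := W.subtype.exists_leftInverse_of_injective W.ker_subtype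
  have hπW : ∀ w : W, π (w : Fin (d + 1) → ℝ) = w := fun w => LinearMap.congr_fun hπ w
  set B : (Fin (d + 1) → ℝ) → Set W := fun x =>
    (fun s => π.toContinuousLinearMap (lineProjection a b x s - z₀)) '' (A ∩ {s | 0 < a ⬝ᵥ s})
  have hdim : dimH (B x ∪ B y) < Module.finrank ℝ W := by
    rw [dimH_union]
    refine (max_le (dimH_lineProjection_le a b x _ z₀ A)
      (dimH_lineProjection_le a b y _ z₀ A)).trans_lt ?_
    have h1 : ((d : ℕ) : ℝ≥0∞) ≤ Module.finrank ℝ W + 1 := by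
      exact_mod_cast le_finrank_ker_prod a b
    exact (ENNReal.add_lt_add_iff_right ENNReal.one_ne_top).1 (hA.trans_le h1)
  obtain ⟨w, hw⟩ := (dense_compl_of_dimH_lt_finrank hdim).nonempty
  have hwab : a ⬝ᵥ (w : Fin (d + 1) → ℝ) = 0 ∧ b ⬝ᵥ (w : Fin (d + 1) → ℝ) = 0 := by
    simpa [hW] using w.2
  have haz : a ⬝ᵥ (z₀ + w) = 1 := by rw [dotProduct_add, haz₀, hwab.1, add_zero]
  have hbz : b ⬝ᵥ (z₀ + w) = 1 := by rw [dotProduct_add, hbz₀, hwab.2, add_zero]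
  have hgood : ∀ x', w ∉ B x' → ∀ s ∈ A ∩ {s | 0 < a ⬝ᵥ s}, z₀ + w ≠ lineProjection a b x' s := by
    intro x' hwB s hs he
    refine hwB ⟨s, hs, ?_⟩
    dsimp only
    rw [← he, add_sub_cancel_left]
    exact hπW w
  have hgx := hP.radial_segment_subset hx hax hbx haz hbz (hgood x fun hB => hw (Or.inl hB))
  have hgy := hP.radial_segment_subset hy hay hby haz hbz (hgood y fun hB => hw (Or.inr hB))
  have hpre : ∀ x', segment ℝ x' (z₀ + w) ⊆ {0}ᶜ →
      IsPreconnected ((fun x => (gauge P x)⁻¹ • x) '' segment ℝ x' (z₀ + w)) := fun x' hx' =>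
    (convex_segment x' _).isPreconnected.image _ (hP.continuousOn_radial.mono hx')
  refine ⟨_, union_subset hgx.2 hgy.2, Or.inl ⟨x, left_mem_segment ℝ _ _, hP.radial_eq_self hx.1⟩,
    Or.inr ⟨y, left_mem_segment ℝ _ _, hP.radial_eq_self hy.1⟩, ?_⟩
  exact (hpre x hgx.1).union _ ⟨_, right_mem_segment ℝ _ _, rfl⟩ ⟨_, right_mem_segment ℝ _ _, rfl⟩
    (hpre y hgy.1)

end Presents

theorem exists_setting (hd : 1 ≤ d) {Δ : Set (Fin (d + 1) → ℝ)} (hΔ : IsReflexive Δ)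
    {h : (Fin (d + 1) → ℤ) → ℤ} (hh : IsHeight Δ h) {Ψ : (Fin (d + 1) → ℝ) → ℝ}
    (hΨ : IsSolution Δ h Ψ) : ∃ S T, Setting Δ h Ψ S T := by
  obtain ⟨S, hS, hpair⟩ := hΔ.exists_presents
  obtain ⟨T, hT, hmem⟩ := hΔ.exists_presents_dualH hh
  exact ⟨S, T, hd, hΔ, hS, hpair, hT, hmem, hΨ⟩

end TropicalMA

end

theorem mainTheorem11 (d : ℕ) (hd : 1 ≤ d)
    (Δ : Set (Fin (d + 1) → ℝ)) (hΔ : TropicalMA.IsReflexive Δ)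
    (h : (Fin (d + 1) → ℤ) → ℤ) (hh : TropicalMA.IsHeight Δ h)
    (hs : TropicalMA.StructurallyStrictlySemistable Δ h)
    (Ψ : (Fin (d + 1) → ℝ) → ℝ) (hΨ : TropicalMA.IsSolution Δ h Ψ) :
    ¬ IsPreconnected (frontier (TropicalMA.dualH Δ h) \ TropicalMA.singularSet Δ h Ψ) ∧
      (TropicalMA.singularSet Δ h Ψ).Nonempty ∧
      dimH (TropicalMA.singularSet Δ h Ψ) + 1 = (d : ENNReal) := by
  obtain ⟨S, T, hset⟩ := TropicalMA.exists_setting hd hΔ hh hΨ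
  have hdis : ¬ IsPreconnected
      (frontier (TropicalMA.dualH Δ h) \ TropicalMA.singularSet Δ h Ψ) := by
    rcases hs.2 with ⟨u, hu, heq⟩ | ⟨v, hv, heq⟩
    · exact hset.not_isPreconnected_of_star hu heq
    · exact hset.not_isPreconnected_of_dualStar hv heq
  refine ⟨hdis, ?_, le_antisymm ?_ (not_lt.1 fun hlt => ?_)⟩
  · by_contra hempty
    rw [Set.not_nonempty_iff_eq_empty.1 hempty, Set.sdiff_empty] at hdis
    exact hdis (hset.presentsH.isPreconnected_frontier hd)
  · exact (add_le_add_left (dimH_mono Set.sdiff_subset) 1).trans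
      (hset.presentsH.dimH_frontier_diff_openFacets_le hd)
  · exact hdis (hset.presentsH.isPreconnected_frontier_diff hlt)
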